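/- **Theorem (Strong Neumann convergence).** Let $X$ be a countable set, let $m\colon X\to(0,\infty)$, and let $(b,c)$ be a connected graph over $(X,m)$. That is, $b\colon X\times X\to[0,\infty)$ satisfies $b(x,y)=b(y,x)$, $b(x,x)=0$ and $\sum_{y\in X}b(x,y)<\infty$ for all $x,y\in X$, $c\colon X\to[0,\infty)$, and any two vertices $x,y$ are joined by a finite sequence $x=x_0,\dots,x_n=y$ with $b(x_j,x_{j+1})>0$ for $0\le j<n$. Let $\ell^2(X,m)$ be the real Hilbert space of all $f\colon X\to\mathbb R$ with $\|f\|^2=\sum_{x\in X} f(x)^2m(x)<\infty$. Let $D(Q^{(N)})$ be the set of all $f\in\ell^2(X,m)$ with $$\sum_{x,y\in X}b(x,y)(f(x)-f(y))^2+\sum_{x\in X}c(x)f(x)^2<\infty,$$ and for $f,g\in D(Q^{(N)})$ put $$Q^{(N)}(f,g)=\frac12\sum_{x,y\in X}b(x,y)(f(x)-f(y))(g(x)-g(y))+\sum_{x\in X}c(x)f(x)g(x).$$ Let $L^{(N)}$ be the operator associated with this form, the Neumann Laplacian: $f$ lies in the domain of $L^{(N)}$ and $L^{(N)}f=g$ if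 and only if $f\in D(Q^{(N)})$, $g\in\ell^2(X,m)$ and $Q^{(N)}(f,h)=\langle g,h\rangle$ for all $h\in D(Q^{(N)})$. Let $(X_k)_{k\ge0}$ be an exhaustion: the $X_k\subseteq X$ are finite, $X_k\subseteq X_{k+1}$, $\bigcup_k X_k=X$, and each graph induced on $X_k$ (by restricting $b$, $c$ and $m$) is connected. Let $L_k^{(N)}$ be the operator on $\ell^2(X_k,m)$ given by $$L_k^{(N)}f(x)=\frac1{m(x)}\sum_{y\in X_k}b(x,y)(f(x)-f(y))+\frac{c(x)}{m(x)}f(x),\qquad x\in X_k.$$ Operators on $\ell^2(X_k,m)$ are regarded as operators on $\ell^2(X,m)$ by first restricting functions to $X_k$ and finally extending the result by $0$. Then for every $\alpha>0$ the bounded inverses $R_\alpha^{(N)}=(L^{(N)}+\alpha)^{-1}$ and $R_{\alpha,k}^{(N)}=(L_k^{(N)}+\alpha)^{-1}$ exist, $-L^{(N)}$ generates a strongly continuous semigroup $P_t^{(N)}=e^{-tL^{(N)}}$, $t\ge0$, of bounded operators on $\ell^2(X,m)$, and, with $P_{t,k}^{(N)}=e^{-tL_k^{(N)}}$: 1. $R_{\alpha,k}^{(N)}f\to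 R_\alpha^{(N)}f$ in $\ell^2(X,m)$ as $k\to\infty$, for every $\alpha>0$ and every $f\in\ell^2(X,m)$; 2. $P_{t,k}^{(N)}f\to P_t^{(N)}f$ in $\ell^2(X,m)$ as $k\to\infty$, for every $t\ge0$ and every $f\in\ell^2(X,m)$. -/

import Mathlib

open MeasureTheory Filter Topology
open scoped NNReal ENNReal

noncomputable section

/-- A graph `(b, c)` over the discrete measure space `(X, m)`. -/
structure WeightedGraph (X : Type*) where
  /-- the vertex measure -/
  m : X → ℝ
  /-- the edge weights -/
  b : X → X → ℝ
  /-- the killing term -/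
  c : X → ℝ
  m_pos : ∀ x, 0 < m x
  b_nonneg : ∀ x y, 0 ≤ b x y
  b_symm : ∀ x y, b x y = b y x
  b_diag : ∀ x, b x x = 0
  b_summable : ∀ x, Summable (b x)
  c_nonneg : ∀ x, 0 ≤ c x

namespace WeightedGraph

variable {X : Type*}

/-- Any two vertices are joined by a finite path along edges of positive weight. -/
def Connected (G : WeightedGraph X) : Prop :=
  ∀ x y, Relation.ReflTransGen (fun u v => 0 < G.b u v) x y

/-- The graph induced on a finite set of vertices: `b`, `c` and `m` are restricted. -/
def induce (G : WeightedGraph X) (S : Finset X) : WeightedGraph S where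
  m x := G.m x
  b x y := G.b x y
  c x := G.c x
  m_pos x := G.m_pos x
  b_nonneg x y := G.b_nonneg x y
  b_symm x y := G.b_symm x y
  b_diag x := G.b_diag x
  b_summable _ := Summable.of_finite
  c_nonneg x := G.c_nonneg x

/-- An exhaustion of the graph: an increasing sequence of finite sets with union `X` whose
induced graphs are connected. -/
structure IsExhaustion (G : WeightedGraph X) (K : ℕ → Finset X) : Prop where
  subset_succ : ∀ k, K k ⊆ K (k + 1)
  exists_mem : ∀ x, ∃ k, x ∈ K k
  connected : ∀ k, (G.induce (K k)).Connected

/-- The energy of `f` is finite. -/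
def FiniteEnergy (G : WeightedGraph X) (f : X → ℝ) : Prop :=
  Summable (fun p : X × X => G.b p.1 p.2 * (f p.1 - f p.2) ^ 2) ∧
    Summable (fun x => G.c x * f x ^ 2)

/-- The energy form `𝒬(f, g)`, for functions of finite energy. -/
def energy (G : WeightedGraph X) (f g : X → ℝ) : ℝ :=
  1 / 2 * ∑' p : X × X, G.b p.1 p.2 * (f p.1 - f p.2) * (g p.1 - g p.2) +
    ∑' x, G.c x * f x * g x

section energy

variable {G : WeightedGraph X} {f g h : X → ℝ}

theorem FiniteEnergy.add (hf : G.FiniteEnergy f) (hg : G.FiniteEnergy g) :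
    G.FiniteEnergy (f + g) := by
  refine ⟨Summable.of_nonneg_of_le (fun p => mul_nonneg (G.b_nonneg _ _) (sq_nonneg _))
      (fun p => ?_) ((hf.1.add hg.1).mul_left 2),
    Summable.of_nonneg_of_le (fun x => mul_nonneg (G.c_nonneg _) (sq_nonneg _))
      (fun x => ?_) ((hf.2.add hg.2).mul_left 2)⟩
  · simp only [Pi.add_apply]
    nlinarith [mul_nonneg (G.b_nonneg p.1 p.2) (sq_nonneg ((f p.1 - f p.2) - (g p.1 - g p.2)))]
  · simp only [Pi.add_apply]
    nlinarith [mul_nonneg (G.c_nonneg x) (sq_nonneg (f x - g x))]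

theorem FiniteEnergy.smul (a : ℝ) (hf : G.FiniteEnergy f) : G.FiniteEnergy (a • f) := by
  refine ⟨(hf.1.mul_left (a ^ 2)).congr fun p => ?_, (hf.2.mul_left (a ^ 2)).congr fun x => ?_⟩
  · simp only [Pi.smul_apply, smul_eq_mul]; ring
  · simp only [Pi.smul_apply, smul_eq_mul]; ring

theorem FiniteEnergy.summable_edge (hf : G.FiniteEnergy f) (hg : G.FiniteEnergy g) :
    Summable (fun p : X × X => G.b p.1 p.2 * (f p.1 - f p.2) * (g p.1 - g p.2)) := by
  refine Summable.of_norm_bounded (hf.1.add hg.1) fun p => ?_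
  have hb := G.b_nonneg p.1 p.2
  rw [Real.norm_eq_abs, abs_le]
  constructor
  · nlinarith [mul_nonneg hb (sq_nonneg ((f p.1 - f p.2) + (g p.1 - g p.2))),
      mul_nonneg hb (sq_nonneg (f p.1 - f p.2)), mul_nonneg hb (sq_nonneg (g p.1 - g p.2))]
  · nlinarith [mul_nonneg hb (sq_nonneg ((f p.1 - f p.2) - (g p.1 - g p.2))),
      mul_nonneg hb (sq_nonneg (f p.1 - f p.2)), mul_nonneg hb (sq_nonneg (g p.1 - g p.2))]

theorem FiniteEnergy.summable_killing (hf : G.FiniteEnergy f) (hg : G.FiniteEnergy g) :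
    Summable (fun x => G.c x * f x * g x) := by
  refine Summable.of_norm_bounded (hf.2.add hg.2) fun x => ?_
  have hc := G.c_nonneg x
  rw [Real.norm_eq_abs, abs_le]
  constructor
  · nlinarith [mul_nonneg hc (sq_nonneg (f x + g x)),
      mul_nonneg hc (sq_nonneg (f x)), mul_nonneg hc (sq_nonneg (g x))]
  · nlinarith [mul_nonneg hc (sq_nonneg (f x - g x)),
      mul_nonneg hc (sq_nonneg (f x)), mul_nonneg hc (sq_nonneg (g x))]

theorem energy_add_left (hf : G.FiniteEnergy f) (hg : G.FiniteEnergy g) (hh : G.FiniteEnergy h) :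
    G.energy (f + g) h = G.energy f h + G.energy g h := by
  unfold energy
  have h1 : ∑' p : X × X, G.b p.1 p.2 * ((f + g) p.1 - (f + g) p.2) * (h p.1 - h p.2) =
      ∑' p : X × X, G.b p.1 p.2 * (f p.1 - f p.2) * (h p.1 - h p.2) +
      ∑' p : X × X, G.b p.1 p.2 * (g p.1 - g p.2) * (h p.1 - h p.2) := by
    rw [← (hf.summable_edge hh).tsum_add (hg.summable_edge hh)]
    refine tsum_congr fun p => ?_
    simp only [Pi.add_apply]; ring
  have h2 : ∑' x, G.c x * (f + g) x * h x =
      ∑' x, G.c x * f x * h x + ∑' x, G.c x * g x * h x := by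
    rw [← (hf.summable_killing hh).tsum_add (hg.summable_killing hh)]
    refine tsum_congr fun x => ?_
    simp only [Pi.add_apply]; ring
  rw [h1, h2]; ring

theorem energy_smul_left (a : ℝ) : G.energy (a • f) h = a * G.energy f h := by
  unfold energy
  have h1 : ∑' p : X × X, G.b p.1 p.2 * ((a • f) p.1 - (a • f) p.2) * (h p.1 - h p.2) =
      a * ∑' p : X × X, G.b p.1 p.2 * (f p.1 - f p.2) * (h p.1 - h p.2) := by
    rw [← tsum_mul_left]
    refine tsum_congr fun p => ?_
    simp only [Pi.smul_apply, smul_eq_mul]; ring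
  have h2 : ∑' x, G.c x * (a • f) x * h x = a * ∑' x, G.c x * f x * h x := by
    rw [← tsum_mul_left]
    refine tsum_congr fun x => ?_
    simp only [Pi.smul_apply, smul_eq_mul]; ring
  rw [h1, h2]; ring

theorem finiteEnergy_zero : G.FiniteEnergy 0 := by
  constructor <;> simp

open Classical in
theorem finiteEnergy_single (G : WeightedGraph X) (x : X) :
    G.FiniteEnergy (Pi.single x 1) := by
  constructor
  · have h1 : Summable (fun p : X × X => if p.1 = x then G.b p.1 p.2 else 0) := by
      have := (Function.Injective.summable_iff (Prod.mk_right_injective x)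
        (f := fun p : X × X => if p.1 = x then G.b p.1 p.2 else 0) ?_).1 ?_
      · exact this
      · rintro ⟨u, v⟩ huv
        rw [if_neg]
        rintro rfl
        exact huv ⟨v, rfl⟩
      · simpa [Function.comp_def] using G.b_summable x
    have h2 : Summable (fun p : X × X => if p.2 = x then G.b p.1 p.2 else 0) := by
      refine ((Equiv.prodComm X X).summable_iff.2 h1).congr fun p => ?_
      simp [G.b_symm p.1 p.2]
    refine Summable.of_nonneg_of_le (fun p => mul_nonneg (G.b_nonneg _ _) (sq_nonneg _))
      (fun p => ?_) (h1.add h2)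
    have hb := G.b_nonneg p.1 p.2
    by_cases hp : p.1 = x <;> by_cases hq : p.2 = x <;> simp [hp, hq]
    simpa [hp] using G.b_nonneg x x
  · refine summable_of_ne_finset_zero (s := {x}) fun y hy => ?_
    have : y ≠ x := by simpa using hy
    simp [this]

end energy

variable [MeasurableSpace X]

/-- The measure on `X` with mass `m x` at each vertex `x`. -/
def measure (G : WeightedGraph X) : Measure X :=
  Measure.sum fun x => ENNReal.ofReal (G.m x) • Measure.dirac x

/-- The real Hilbert space `ℓ²(X, m)`. Every vertex has positive mass, so an element is a
function on `X`, not merely a class of functions. -/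
abbrev Ell2 (G : WeightedGraph X) : Type _ := Lp ℝ 2 G.measure

variable [DiscreteMeasurableSpace X]

theorem ae_iff_forall (G : WeightedGraph X) {p : X → Prop} :
    (∀ᵐ x ∂G.measure, p x) ↔ ∀ x, p x := by
  unfold measure
  rw [Measure.ae_sum_iff' .of_discrete]
  refine forall_congr' fun x => ?_
  have hx : ENNReal.ofReal (G.m x) ≠ 0 := (ENNReal.ofReal_pos.2 (G.m_pos x)).ne'
  rw [ae_iff, Measure.smul_apply, smul_eq_mul, mul_eq_zero, or_iff_right hx, ← ae_iff,
    ae_dirac_iff .of_discrete]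

theorem coe_toLp (G : WeightedGraph X) {f : X → ℝ} (hf : MemLp f 2 G.measure) :
    ⇑(hf.toLp f) = f :=
  funext (G.ae_iff_forall.1 hf.coeFn_toLp)

theorem coe_zero (G : WeightedGraph X) : ⇑(0 : G.Ell2) = 0 :=
  funext (G.ae_iff_forall.1 (Lp.coeFn_zero ℝ 2 G.measure))

theorem coe_add (G : WeightedGraph X) (f g : G.Ell2) : ⇑(f + g) = ⇑f + ⇑g :=
  funext (G.ae_iff_forall.1 (Lp.coeFn_add f g))

theorem coe_smul (G : WeightedGraph X) (a : ℝ) (f : G.Ell2) : ⇑(a • f) = a • ⇑f :=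
  funext (G.ae_iff_forall.1 (Lp.coeFn_smul a f))

theorem ell2_ext {G : WeightedGraph X} {f g : G.Ell2} (h : ⇑f = ⇑g) : f = g :=
  Lp.ext (G.ae_iff_forall.2 (congrFun h))

theorem measure_singleton (G : WeightedGraph X) (x : X) :
    G.measure {x} = ENNReal.ofReal (G.m x) := by
  classical
  unfold measure
  rw [Measure.sum_apply _ .of_discrete, tsum_eq_single x]
  · simp
  · intro y hy
    simp [hy]

/-- Finitely supported functions belong to `ℓ²(X, m)`. -/
theorem memLp_of_finset (G : WeightedGraph X) (S : Finset X) {f : X → ℝ}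
    (hf : ∀ x ∉ S, f x = 0) : MemLp f 2 G.measure := by
  classical
  have : f = ∑ x ∈ S, ({x} : Set X).indicator (fun _ => f x) := by
    funext y
    rw [Finset.sum_apply]
    by_cases hy : y ∈ S
    · rw [Finset.sum_eq_single y] <;> simp +contextual [hy, eq_comm]
    · rw [hf y hy, Finset.sum_eq_zero]
      intro x hx
      have : y ≠ x := by rintro rfl; exact hy hx
      simp [this]
  rw [this]
  refine memLp_finsetSum' _ fun x _ => ?_
  refine memLp_indicator_const _ .of_discrete _ (Or.inr ?_)
  rw [measure_singleton]
  exact ENNReal.ofReal_ne_top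

/-- The domain `D(Q^(N)) = 𝒟 ∩ ℓ²(X, m)` of the Neumann form. -/
def neumannFormDomain (G : WeightedGraph X) : Submodule ℝ G.Ell2 where
  carrier := {f | G.FiniteEnergy f}
  zero_mem' := by
    change G.FiniteEnergy _
    rw [coe_zero]; exact finiteEnergy_zero
  add_mem' {f g} hf hg := by
    change G.FiniteEnergy _
    rw [coe_add]; exact FiniteEnergy.add hf hg
  smul_mem' a f hf := by
    change G.FiniteEnergy _
    rw [coe_smul]; exact FiniteEnergy.smul a hf

/-- The graph of the operator that comes from the Neumann form: the pairs `(f, g)` with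
`f ∈ D(Q^(N))` and `𝒬(f, h) = ⟨g, h⟩` for all `h ∈ D(Q^(N))`. -/
def neumannLaplacianGraph (G : WeightedGraph X) : Submodule ℝ (G.Ell2 × G.Ell2) where
  carrier := {p | p.1 ∈ G.neumannFormDomain ∧
    ∀ h ∈ G.neumannFormDomain, G.energy p.1 h = inner ℝ p.2 h}
  zero_mem' := by
    refine ⟨Submodule.zero_mem _, fun h _ => ?_⟩
    simp only [Prod.fst_zero, Prod.snd_zero, inner_zero_left, coe_zero]
    simp [energy]
  add_mem' {p q} hp hq := by
    refine ⟨Submodule.add_mem _ hp.1 hq.1, fun h hh => ?_⟩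
    rw [Prod.fst_add, Prod.snd_add, coe_add, inner_add_left, ← hp.2 h hh, ← hq.2 h hh]
    exact energy_add_left hp.1 hq.1 hh
  smul_mem' a p hp := by
    refine ⟨Submodule.smul_mem _ a hp.1, fun h hh => ?_⟩
    rw [Prod.smul_fst, Prod.smul_snd, coe_smul, real_inner_smul_left, ← hp.2 h hh]
    exact energy_smul_left a

/-- The Neumann Laplacian `L^(N)`, an unbounded operator in `ℓ²(X, m)`. -/
def neumannLaplacian (G : WeightedGraph X) : G.Ell2 →ₗ.[ℝ] G.Ell2 :=
  G.neumannLaplacianGraph.toLinearPMap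

/-- The graph of the Neumann Laplacian is single-valued, so that `neumannLaplacian` is the
operator with this graph. -/
theorem graph_neumannLaplacian (G : WeightedGraph X) :
    G.neumannLaplacian.graph = G.neumannLaplacianGraph := by
  classical
  refine Submodule.toLinearPMap_graph_eq _ fun p hp hp1 => ell2_ext (funext fun x => ?_)
  have hmem : MemLp (Pi.single x (1 : ℝ)) 2 G.measure :=
    G.memLp_of_finset {x} fun y hy => by
      have : y ≠ x := by simpa using hy
      simp [this]
  have hdom : hmem.toLp _ ∈ G.neumannFormDomain := by
    change G.FiniteEnergy _
    rw [coe_toLp]; exact G.finiteEnergy_single x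
  have h0 := hp.2 _ hdom
  have hz : hmem.toLp _ = indicatorConstLp 2 (μ := G.measure) (s := {x}) .of_discrete
      (by rw [measure_singleton]; exact ENNReal.ofReal_ne_top) (1 : ℝ) := by
    refine Lp.ext ?_
    filter_upwards [hmem.coeFn_toLp, indicatorConstLp_coeFn (p := 2) (μ := G.measure)
      (s := {x}) (hs := .of_discrete)
      (hμs := by rw [measure_singleton]; exact ENNReal.ofReal_ne_top) (c := (1 : ℝ))] with y h1 h2
    rw [h1, h2]
    simp [Pi.single_apply, Set.indicator_apply]
  rw [hp1, coe_zero, hz, real_inner_comm, L2.inner_indicatorConstLp_one] at h0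
  have hx : (G.measure.real {x}) * (p.2 : X → ℝ) x = 0 := by
    have h3 : G.energy 0 ⇑(hmem.toLp (Pi.single x (1 : ℝ))) = 0 := by simp [energy]
    rw [hz] at h3
    rw [h3] at h0
    rw [integral_singleton] at h0
    simpa using h0.symm
  have hm : G.measure.real {x} ≠ 0 := by
    rw [measureReal_def, measure_singleton, ENNReal.toReal_ofReal (G.m_pos x).le]
    exact (G.m_pos x).ne'
  rw [coe_zero]
  simpa [hm] using hx

end WeightedGraph

/-- The bounded operator `R` is `(L + α)⁻¹`: the operator `L + α` maps the domain of `L`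
bijectively onto the whole space, with inverse `R`. -/
def IsResolventOf {H : Type*} [NormedAddCommGroup H] [NormedSpace ℝ H]
    (L : H →ₗ.[ℝ] H) (α : ℝ) (R : H →L[ℝ] H) : Prop :=
  ∀ f g : H, R g = f ↔ ∃ u : L.domain, (u : H) = f ∧ L u + α • (u : H) = g

/-- `P` is the semigroup `(e^{-tL})_{t ≥ 0}`: the strongly continuous semigroup of bounded
operators whose infinitesimal generator (with its exact domain) is `-L`. -/
structure IsSemigroupOf {H : Type*} [NormedAddCommGroup H] [NormedSpace ℝ H]
    (L : H →ₗ.[ℝ] H) (P : ℝ≥0 → H →L[ℝ] H) : Prop where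
  zero : P 0 = 1
  add : ∀ s t, P (s + t) = P s * P t
  continuous : ∀ f, Continuous fun t => P t f
  generator : ∀ f g : H, (∃ u : L.domain, (u : H) = f ∧ L u = g) ↔
    Tendsto (fun t : ℝ≥0 => (t : ℝ)⁻¹ • (P t f - f)) (𝓝[>] 0) (𝓝 (-g))

namespace WeightedGraph

variable {X : Type*} [MeasurableSpace X] [DiscreteMeasurableSpace X]

open Classical in
/-- The resolvent `R_α^(N) = (L^(N) + α)⁻¹` (and `0` should there be none). -/
def neumannResolvent (G : WeightedGraph X) (α : ℝ) : G.Ell2 →L[ℝ] G.Ell2 :=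
  if h : ∃ R, IsResolventOf G.neumannLaplacian α R then h.choose else 0

open Classical in
/-- The semigroup `P_t^(N) = e^{-tL^(N)}` (and `0` should there be none). -/
def neumannSemigroup (G : WeightedGraph X) : ℝ≥0 → G.Ell2 →L[ℝ] G.Ell2 :=
  if h : ∃ P, IsSemigroupOf G.neumannLaplacian P then h.choose else 0

/-- Over a finite vertex set every function is square summable. -/
def ell2EquivFun [Finite X] (G : WeightedGraph X) : G.Ell2 ≃ₗ[ℝ] (X → ℝ) where
  toFun f := f
  map_add' := G.coe_add
  map_smul' := G.coe_smul
  invFun f := (G.memLp_of_finset (Set.finite_univ (α := X)).toFinset (f := f) (by simp)).toLp f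
  left_inv f := ell2_ext (G.coe_toLp _)
  right_inv f := G.coe_toLp _

instance [Finite X] (G : WeightedGraph X) : FiniteDimensional ℝ G.Ell2 :=
  G.ell2EquivFun.symm.finiteDimensional

/-- The Laplacian of a finite graph as a linear map on functions:
`f ↦ (x ↦ (1 / m x) ∑ y, b x y (f x - f y) + (c x / m x) f x)`. -/
def finiteLaplacianFun {V : Type*} [Fintype V] (G : WeightedGraph V) :
    (V → ℝ) →ₗ[ℝ] (V → ℝ) where
  toFun f x := 1 / G.m x * ∑ y, G.b x y * (f x - f y) + G.c x / G.m x * f x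
  map_add' f g := by
    funext x
    have : ∑ y, G.b x y * ((f + g) x - (f + g) y) =
        ∑ y, G.b x y * (f x - f y) + ∑ y, G.b x y * (g x - g y) := by
      rw [← Finset.sum_add_distrib]
      refine Finset.sum_congr rfl fun y _ => ?_
      simp only [Pi.add_apply]; ring
    rw [this]
    simp only [Pi.add_apply]; ring
  map_smul' a f := by
    funext x
    have : ∑ y, G.b x y * ((a • f) x - (a • f) y) = a * ∑ y, G.b x y * (f x - f y) := by
      rw [Finset.mul_sum]
      refine Finset.sum_congr rfl fun y _ => ?_
      simp only [Pi.smul_apply, smul_eq_mul]; ring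
    rw [this]
    simp only [Pi.smul_apply, smul_eq_mul, RingHom.id_apply]; ring

/-- The Laplacian of a finite graph as a (bounded) operator on `ℓ²`. -/
def finiteLaplacian {V : Type*} [Fintype V] [MeasurableSpace V] [DiscreteMeasurableSpace V]
    (G : WeightedGraph V) : G.Ell2 →L[ℝ] G.Ell2 :=
  LinearMap.toContinuousLinearMap
    (G.ell2EquivFun.symm.toLinearMap ∘ₗ G.finiteLaplacianFun ∘ₗ G.ell2EquivFun.toLinearMap)

/-- The Neumann restriction `L_k^(N)` of the Laplacian to the finite set `S = X_k`: the
Laplacian of the induced graph, on `ℓ²(X_k, m)`. -/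
def restrictedLaplacian (G : WeightedGraph X) (S : Finset X) :
    (G.induce S).Ell2 →L[ℝ] (G.induce S).Ell2 :=
  (G.induce S).finiteLaplacian

/-- Restriction of functions, `ℓ²(X, m) → ℓ²(S, m)`. -/
def restrict (G : WeightedGraph X) (S : Finset X) : G.Ell2 →ₗ[ℝ] (G.induce S).Ell2 where
  toFun f := (G.induce S).ell2EquivFun.symm fun x => f x
  map_add' f g := by rw [← map_add, coe_add]; rfl
  map_smul' a f := by rw [← map_smul, coe_smul]; rfl

open Classical in
/-- Extension of functions by zero, `ℓ²(S, m) → ℓ²(X, m)`. -/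
def extendByZero (G : WeightedGraph X) (S : Finset X) : (G.induce S).Ell2 →ₗ[ℝ] G.Ell2 where
  toFun u := (G.memLp_of_finset S (f := fun x => if h : x ∈ S then u ⟨x, h⟩ else 0)
    fun x hx => dif_neg hx).toLp _
  map_add' u v := by
    refine ell2_ext ?_
    simp only [coe_add, coe_toLp]
    funext x
    by_cases h : x ∈ S <;> simp [h]
  map_smul' a u := by
    refine ell2_ext ?_
    simp only [coe_smul, coe_toLp]
    funext x
    by_cases h : x ∈ S <;> simp [h]

/-- The restricted Neumann resolvent `R_{α,k}^(N) = (L_k^(N) + α)⁻¹` for `S = X_k`, regarded as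
an operator on `ℓ²(X, m)` by restricting and extending by zero. -/
def restrictedResolvent (G : WeightedGraph X) (S : Finset X) (α : ℝ) : G.Ell2 →ₗ[ℝ] G.Ell2 :=
  G.extendByZero S ∘ₗ
    (Ring.inverse (G.restrictedLaplacian S + α • 1)).toLinearMap ∘ₗ G.restrict S

/-- The restricted Neumann semigroup `P_{t,k}^(N) = e^{-tL_k^(N)}` for `S = X_k`, regarded as
operators on `ℓ²(X, m)` by restricting and extending by zero. -/
def restrictedSemigroup (G : WeightedGraph X) (S : Finset X) (t : ℝ≥0) :
    G.Ell2 →ₗ[ℝ] G.Ell2 :=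
  G.extendByZero S ∘ₗ
    (NormedSpace.exp (-(t : ℝ) • G.restrictedLaplacian S)).toLinearMap ∘ₗ G.restrict S

end WeightedGraph

end

/-! Let J_k be extension by zero from ℓ²(X_k, m) to ℓ²(X, m); its adjoint is restriction and J_k*
J_k = 1. The bounded operator B_k = J_k L_k J_k* (`extendedLaplacian`) has as quadratic form the
energy over vertices and edges inside X_k. These forms increase with k, and a function in ℓ² has
finite energy exactly when they stay bounded on it. Their supremum is thus the Neumann form.

Monotone convergence of forms gives strong convergence of (B_k + α)⁻¹ to (L + α)⁻¹
(`exists_tendsto_inverse_add_smul_one`, `IsExhaustion.exists_isResolventOf`).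

Semigroups follow from resolvents by Euler's formula: e^{-tB} is approximated by ((n/t)(B +
n/t)⁻¹)^n with an error at most (2t²/n)‖B²x‖. On vectors (B_k + 1)⁻² g this error is uniform in k,
and such vectors approximate a dense set (`cauchySeq_exp_neg_smul_apply`). The limits form a
contraction semigroup whose generator is -L (`exists_isSemigroupOf_tendsto`).

Finally B_k J_k = J_k L_k, so the restricted resolvents and semigroups are those of B_k applied to
J_k J_k* f, and J_k J_k* f → f. Uniform bounds allow this moving argument. -/

namespace ContinuousLinearMap

/-! ### Bounded accretive operators: semigroup, resolvent, Euler's formula -/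

variable {H : Type*} [NormedAddCommGroup H] [InnerProductSpace ℝ H]

theorem exp_neg_smul_apply_comm (B : H →L[ℝ] H) (x : H) (t : ℝ) :
    NormedSpace.exp (-t • B) (B x) = B (NormedSpace.exp (-t • B) x) := by
  have h : Commute (NormedSpace.exp (-t • B)) B :=
    ((Commute.refl B).smul_left (-t)).exp_left
  exact congrArg (fun T : H →L[ℝ] H => T x) h.eq

/-- Telescoping turns a one-step error into an n-step error. Commutation lets U - V act directly on
x, so only the error at x enters. -/
theorem norm_pow_apply_sub_pow_apply_le {U V : H →L[ℝ] H} (hUV : Commute U V)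
    (hU : ∀ x, ‖U x‖ ≤ ‖x‖) (hV : ∀ x, ‖V x‖ ≤ ‖x‖) (n : ℕ) (x : H) :
    ‖(U ^ n) x - (V ^ n) x‖ ≤ n * ‖U x - V x‖ := by
  induction n with
  | zero => simp
  | succ n ih =>
    have hVn : ∀ y, ‖(V ^ n) y‖ ≤ ‖y‖ := by
      intro y
      clear ih
      induction n with
      | zero => simp
      | succ n ih => rw [pow_succ', mul_apply_eq_comp]; exact (hV _).trans ih
    have hc : U ((V ^ n) x) = (V ^ n) (U x) :=
      congrArg (fun T : H →L[ℝ] H => T x) (hUV.pow_right n).eq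
    have : (U ^ (n + 1)) x - (V ^ (n + 1)) x =
        U ((U ^ n) x - (V ^ n) x) + (V ^ n) (U x - V x) := by
      rw [pow_succ', pow_succ, mul_apply_eq_comp, mul_apply_eq_comp, map_sub, map_sub, hc]
      abel
    rw [this]
    refine (norm_add_le _ _).trans ?_
    rw [Nat.cast_succ]
    linarith [hU ((U ^ n) x - (V ^ n) x), hVn (U x - V x)]

variable [CompleteSpace H]

section Accretive

variable {B : H →L[ℝ] H}

theorem hasDerivAt_exp_neg_smul_apply (B : H →L[ℝ] H) (x : H) (t : ℝ) :
    HasDerivAt (fun s : ℝ => NormedSpace.exp (-s • B) x)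
      (-(NormedSpace.exp (-t • B) (B x))) t := by
  have h := (hasDerivAt_exp_smul_const (𝕂 := ℝ) B (-t)).scomp t (hasDerivAt_neg t)
  have h2 := h.clm_apply (hasDerivAt_const t x)
  simpa [Function.comp_def] using h2

theorem exp_neg_add_smul (B : H →L[ℝ] H) (s t : ℝ) :
    NormedSpace.exp (-(s + t) • B) = NormedSpace.exp (-s • B) * NormedSpace.exp (-t • B) := by
  let _ : NormedAlgebra ℚ (H →L[ℝ] H) := NormedAlgebra.restrictScalars ℚ ℝ _
  rw [neg_add, add_smul,
    NormedSpace.exp_add_of_commute (((Commute.refl B).smul_left _).smul_right _)]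

/-- The semigroup of a bounded accretive operator is contractive. -/
theorem norm_exp_neg_smul_apply_le (hB : ∀ x, 0 ≤ inner ℝ (B x) x) {t : ℝ} (ht : 0 ≤ t) (x : H) :
    ‖NormedSpace.exp (-t • B) x‖ ≤ ‖x‖ := by
  -- With y = e^{-sB}x, the derivative of ‖y‖² is -2⟨By, y⟩ ≤ 0.
  have hd : ∀ s : ℝ, HasDerivAt (fun s : ℝ => ‖NormedSpace.exp (-s • B) x‖ ^ 2)
      (2 * inner ℝ (NormedSpace.exp (-s • B) x) (-(NormedSpace.exp (-s • B) (B x)))) s :=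
    fun s => (hasDerivAt_exp_neg_smul_apply B x s).norm_sq
  have hanti : Antitone fun s : ℝ => ‖NormedSpace.exp (-s • B) x‖ ^ 2 := by
    refine antitone_of_deriv_nonpos (fun s => (hd s).differentiableAt) fun s => ?_
    rw [(hd s).deriv, exp_neg_smul_apply_comm, inner_neg_right, real_inner_comm]
    linarith [hB (NormedSpace.exp (-s • B) x)]
  have h := hanti ht
  simp only [neg_zero, zero_smul, NormedSpace.exp_zero, one_apply_eq_self] at h
  exact (sq_le_sq₀ (norm_nonneg _) (norm_nonneg _)).1 h

theorem norm_exp_neg_smul_apply_sub_le (hB : ∀ x, 0 ≤ inner ℝ (B x) x) {t : ℝ} (ht : 0 ≤ t)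
    (x : H) : ‖NormedSpace.exp (-t • B) x - x‖ ≤ t * ‖B x‖ := by
  have h := norm_image_sub_le_of_norm_deriv_le_segment' (a := 0) (b := t) (C := ‖B x‖)
    (fun s _ => (hasDerivAt_exp_neg_smul_apply B x s).hasDerivWithinAt)
    (fun s hs => by
      rw [norm_neg]; exact norm_exp_neg_smul_apply_le hB hs.1 _) t (Set.right_mem_Icc.2 ht)
  simp only [neg_zero, zero_smul, NormedSpace.exp_zero, one_apply_eq_self, sub_zero] at h
  linarith

/-- The derivative of e^{-sB}x - x + sBx is Bx - e^{-sB}Bx, which the first-order estimate at Bx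
controls. Bounding s by t costs the usual factor 1/2. -/
theorem norm_exp_neg_smul_apply_sub_add_le (hB : ∀ x, 0 ≤ inner ℝ (B x) x) {t : ℝ} (ht : 0 ≤ t)
    (x : H) : ‖NormedSpace.exp (-t • B) x - x + t • B x‖ ≤ t ^ 2 * ‖B (B x)‖ := by
  have h := norm_image_sub_le_of_norm_deriv_le_segment' (a := 0) (b := t) (C := t * ‖B (B x)‖)
    (fun s _ => ((hasDerivAt_exp_neg_smul_apply B x s).add
      ((hasDerivAt_id s).smul_const (B x))).hasDerivWithinAt)
    (fun s hs => by
      rw [one_smul, neg_add_eq_sub, norm_sub_rev]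
      exact (norm_exp_neg_smul_apply_sub_le hB hs.1 _).trans
        (mul_le_mul_of_nonneg_right hs.2.le (norm_nonneg _))) t (Set.right_mem_Icc.2 ht)
  simp only [Pi.add_apply, neg_zero, zero_smul, NormedSpace.exp_zero, one_apply_eq_self, sub_zero, id,
    add_zero] at h
  rw [sub_add_eq_add_sub]
  calc _ ≤ _ := h
    _ = _ := by ring

/-- Coercivity: ⟨(B + α)x, x⟩ ≥ α‖x‖². -/
theorem isUnit_add_smul_one (hB : ∀ x, 0 ≤ inner ℝ (B x) x) {α : ℝ} (hα : 0 < α) :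
    IsUnit (B + α • 1) := by
  refine isUnit_of_forall_le_norm_inner_map _ (c := ⟨α, hα.le⟩) hα fun x => ?_
  refine le_trans ?_ (le_abs_self _)
  simp only [add_apply, smul_apply, one_apply_eq_self, inner_add_left, real_inner_smul_left,
    real_inner_self_eq_norm_sq]
  change ‖x‖ ^ 2 * α ≤ _
  linarith [hB x]

theorem apply_inverse_add_smul_one (hB : ∀ x, 0 ≤ inner ℝ (B x) x) {α : ℝ} (hα : 0 < α) (x : H) :
    B (Ring.inverse (B + α • 1) x) = x - α • Ring.inverse (B + α • 1) x := by
  have h := congrArg (fun T : H →L[ℝ] H => T x)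
    (Ring.mul_inverse_cancel _ (isUnit_add_smul_one hB hα))
  simp only [mul_apply_eq_comp, add_apply, smul_apply, one_apply_eq_self] at h
  exact eq_sub_of_add_eq h

theorem inverse_add_smul_one_apply (hB : ∀ x, 0 ≤ inner ℝ (B x) x) {α : ℝ} (hα : 0 < α) (x : H) :
    Ring.inverse (B + α • 1) (B x + α • x) = x := by
  have h := congrArg (fun T : H →L[ℝ] H => T x)
    (Ring.inverse_mul_cancel _ (isUnit_add_smul_one hB hα))
  simpa only [mul_apply_eq_comp, add_apply, smul_apply, one_apply_eq_self] using h

theorem norm_inverse_add_smul_one_apply_le (hB : ∀ x, 0 ≤ inner ℝ (B x) x) {α : ℝ} (hα : 0 < α)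
    (x : H) : α * ‖Ring.inverse (B + α • 1) x‖ ≤ ‖x‖ := by
  set u := Ring.inverse (B + α • 1) x with hu
  have h : B u = x - α • u := apply_inverse_add_smul_one hB hα x
  have h1 := hB u
  rw [h, inner_sub_left, real_inner_smul_left, real_inner_self_eq_norm_sq] at h1
  have h2 := real_inner_le_norm x u
  rcases (norm_nonneg u).eq_or_lt with h0 | h0
  · rw [← h0]; simp
  · nlinarith

/-- Quantitative version of Euler's exponential formula for a bounded accretive operator. -/
theorem norm_exp_neg_smul_apply_sub_pow_le (hB : ∀ x, 0 ≤ inner ℝ (B x) x) {t : ℝ} (ht : 0 < t)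
    {n : ℕ} (hn : n ≠ 0) (x : H) :
    ‖NormedSpace.exp (-t • B) x -
      ((((n : ℝ) / t) • Ring.inverse (B + ((n : ℝ) / t) • 1)) ^ n) x‖ ≤
      2 * t ^ 2 / n * ‖B (B x)‖ := by
  have hn' : (0 : ℝ) < n := by positivity
  set α : ℝ := n / t with hα
  have hα0 : 0 < α := by positivity
  set V := α • Ring.inverse (B + α • 1) with hV
  have hexp : NormedSpace.exp (-t • B) = NormedSpace.exp (-(t / n) • B) ^ n := by
    let _ : NormedAlgebra ℚ (H →L[ℝ] H) := NormedAlgebra.restrictScalars ℚ ℝ _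
    rw [← NormedSpace.exp_nsmul, ← Nat.cast_smul_eq_nsmul ℝ, smul_smul]
    congr 2
    field_simp
  have hVle : ∀ y, ‖V y‖ ≤ ‖y‖ := fun y => by
    rw [hV, smul_apply, norm_smul, Real.norm_of_nonneg hα0.le]
    exact norm_inverse_add_smul_one_apply_le hB hα0 y
  have hBV : Commute B V := by
    refine Commute.smul_right ?_ α
    ext y
    simp only [mul_apply_eq_comp]
    rw [apply_inverse_add_smul_one hB hα0, eq_comm, eq_sub_iff_add_eq, ← map_smul, ← map_add,
      inverse_add_smul_one_apply hB hα0]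
  have hcomm : Commute (NormedSpace.exp (-(t / n) • B)) V := (hBV.smul_left _).exp_left
  have hBVx : ∀ y, B (V y) = V (B y) := fun y =>
    congrArg (fun T : H →L[ℝ] H => T y) hBV.eq
  have hVy : ∀ y, V y = y - (t / n) • B (V y) := fun y => by
    have h := apply_inverse_add_smul_one hB hα0 y
    have h2 : B (V y) = α • (y - V y) := by
      rw [hV, smul_apply, map_smul, h]
    rw [h2, smul_smul, show t / n * α = 1 by rw [hα]; field_simp]
    simp
  -- Substituting the resolvent equation V = 1 - (t/n)BV into itself gives the Taylor expansion of V
  -- to the same order as that of e^{-(t/n)B}.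
  have hexpand : V x = x - (t / n) • B x + (t / n) ^ 2 • V (B (B x)) := by
    conv_lhs => rw [hVy x, hBVx, hVy (B x), hBVx]
    rw [smul_sub, smul_smul, sq]
    abel
  have hle : ‖NormedSpace.exp (-(t / n) • B) x - V x‖ ≤ 2 * (t / n) ^ 2 * ‖B (B x)‖ := by
    have : NormedSpace.exp (-(t / n) • B) x - V x =
        (NormedSpace.exp (-(t / n) • B) x - x + (t / n) • B x) - (t / n) ^ 2 • V (B (B x)) := by
      rw [hexpand]; abel
    rw [this]
    refine (norm_sub_le _ _).trans ?_
    have h1 := norm_exp_neg_smul_apply_sub_add_le hB (t := t / n) (by positivity) x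
    have h2 : ‖(t / n) ^ 2 • V (B (B x))‖ ≤ (t / n) ^ 2 * ‖B (B x)‖ := by
      rw [norm_smul, Real.norm_of_nonneg (by positivity)]
      exact mul_le_mul_of_nonneg_left (hVle _) (by positivity)
    linarith
  rw [hexp]
  refine (norm_pow_apply_sub_pow_apply_le hcomm
    (norm_exp_neg_smul_apply_le hB (by positivity)) hVle n x).trans ?_
  calc _ ≤ (n : ℝ) * (2 * (t / n) ^ 2 * ‖B (B x)‖) := mul_le_mul_of_nonneg_left hle hn'.le
    _ = _ := by field_simp

end Accretive

/-! ### Monotone convergence of bounded forms -/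

section MonotoneForms

variable {B : ℕ → H →L[ℝ] H}

/-- For a monotone sequence of bounded nonnegative symmetric operators the resolvents converge
strongly, and the limit solves the resolvent equation of the limit form. -/
theorem exists_tendsto_inverse_add_smul_one
    (hsymm : ∀ k x y, inner ℝ (B k x) y = inner ℝ x (B k y))
    (hB : ∀ k x, 0 ≤ inner ℝ (B k x) x)
    (hmono : ∀ x, Monotone fun k => inner ℝ (B k x) x) {α : ℝ} (hα : 0 < α) (f : H) :
    ∃ u, Tendsto (fun k => Ring.inverse (B k + α • 1) f) atTop (𝓝 u) ∧
      (∃ C, ∀ k, inner ℝ (B k u) u ≤ C) ∧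
      ∀ h, (∃ C, ∀ k, inner ℝ (B k h) h ≤ C) →
        Tendsto (fun k => inner ℝ (B k u) h) atTop (𝓝 (inner ℝ (f - α • u) h)) := by
  set v : ℕ → H := fun k => Ring.inverse (B k + α • 1) f with hv
  have hBv : ∀ k, B k (v k) = f - α • v k := fun k => apply_inverse_add_smul_one (hB k) hα f
  -- Expand the form of B_k + α at v_k - v_l: the mixed terms equal ⟨f, v_l⟩, and the form of B_k at
  -- v_l is at most that of B_l. The decreasing numbers ⟨f, v_k⟩ ≥ 0 then control both the norm and
  -- the energy of differences.
  have key : ∀ k l, k ≤ l → inner ℝ (B k (v k - v l)) (v k - v l) + α * ‖v k - v l‖ ^ 2 ≤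
      inner ℝ f (v k) - inner ℝ f (v l) := by
    intro k l hkl
    have h1 : inner ℝ (B k (v l)) (v l) ≤ inner ℝ (B l (v l)) (v l) := hmono (v l) hkl
    have h2 : inner ℝ (B k (v l)) (v k) = inner ℝ (B k (v k)) (v l) := by
      rw [hsymm, real_inner_comm]
    rw [← real_inner_self_eq_norm_sq]
    simp only [map_sub, inner_sub_left, inner_sub_right, h2]
    rw [hBv l, inner_sub_left, real_inner_smul_left] at h1
    rw [hBv k]
    simp only [inner_sub_left, real_inner_smul_left]
    rw [real_inner_comm (v k) (v l)]
    linarith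
  have hanti : Antitone fun k => inner ℝ f (v k) := fun k l hkl => by
    have := key k l hkl
    have := hB k (v k - v l)
    have : 0 ≤ α * ‖v k - v l‖ ^ 2 := by positivity
    change inner ℝ f (v l) ≤ inner ℝ f (v k)
    linarith
  have hq : ∀ k, inner ℝ (B k (v k)) (v k) ≤ inner ℝ f (v k) := fun k => by
    rw [hBv k, inner_sub_left, real_inner_smul_left, real_inner_self_eq_norm_sq]
    have : 0 ≤ α * ‖v k‖ ^ 2 := by positivity
    linarith
  obtain ⟨a, ha⟩ : ∃ a, Tendsto (fun k => inner ℝ f (v k)) atTop (𝓝 a) :=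
    ⟨_, tendsto_atTop_ciInf hanti ⟨0, by
      rintro _ ⟨k, rfl⟩
      exact (hB k (v k)).trans (hq k)⟩⟩
  have hle : ∀ k, a ≤ inner ℝ f (v k) := fun k => hanti.le_of_tendsto ha k
  have hcauchy : CauchySeq v := by
    have hz : Tendsto (fun k => √((inner ℝ f (v k) - a) / α)) atTop (𝓝 0) := by
      have := ((ha.sub_const a).div_const α).sqrt
      simpa using this
    refine cauchySeq_of_le_tendsto_0' _ (fun k l hkl => ?_) hz
    rw [dist_eq_norm]
    refine Real.le_sqrt_of_sq_le ?_
    rw [le_div_iff₀ hα]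
    have := key k l hkl
    have := hB k (v k - v l)
    linarith [hle l]
  obtain ⟨u, hu⟩ := cauchySeq_tendsto_of_complete hcauchy
  -- Let l → ∞ in `key` with k fixed, where B_k is continuous.
  have htail : ∀ k, inner ℝ (B k (v k - u)) (v k - u) ≤ inner ℝ f (v k) - a := by
    intro k
    have h1 : Tendsto (fun l => inner ℝ (B k (v k - v l)) (v k - v l)) atTop
        (𝓝 (inner ℝ (B k (v k - u)) (v k - u))) := by
      have h := hu.const_sub (v k)
      exact (((B k).continuous.tendsto _).comp h).inner h
    refine le_of_tendsto_of_tendsto h1 (ha.const_sub _) ?_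
    filter_upwards [eventually_ge_atTop k] with l hl
    have := key k l hl
    have : 0 ≤ α * ‖v k - v l‖ ^ 2 := by positivity
    linarith
  refine ⟨u, hu, ⟨inner ℝ f (v 0), fun k => ?_⟩, fun h ⟨C, hC⟩ => ?_⟩
  -- For l ≥ k the k-th form at v_l is at most the l-th, hence at most ⟨f, v_l⟩ ≤ ⟨f, v_0⟩; then let
  -- l → ∞.
  · refine le_of_tendsto ((((B k).continuous.tendsto _).comp hu).inner hu) ?_
    filter_upwards [eventually_ge_atTop k] with l hl
    exact ((hmono (v l) hl).trans (hq l)).trans (hanti (Nat.zero_le l))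
  -- Cauchy–Schwarz for the possibly degenerate form of B_k, from the discriminant of its values at
  -- x + sy.
  · have hcs : ∀ k (x y : H), inner ℝ (B k x) y ^ 2 ≤ inner ℝ (B k x) x * inner ℝ (B k y) y := by
      intro k x y
      have hdisc := discrim_le_zero (a := inner ℝ (B k y) y) (b := 2 * inner ℝ (B k x) y)
        (c := inner ℝ (B k x) x) fun s => by
          have h0 := hB k (x + s • y)
          have h2 : inner ℝ (B k y) x = inner ℝ (B k x) y := by rw [hsymm, real_inner_comm]
          simp only [map_add, map_smul, inner_add_left, inner_add_right, real_inner_smul_left,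
            real_inner_smul_right, h2] at h0
          linarith
      rw [discrim] at hdisc
      linarith
    -- The energy of v_k - u tends to 0 by `htail` while that of h stays below C, so u may replace
    -- v_k in the resolvent equation.
    have hdiff : Tendsto (fun k => inner ℝ (B k (v k - u)) h) atTop (𝓝 0) := by
      have hz : Tendsto (fun k => √((inner ℝ f (v k) - a) * C)) atTop (𝓝 0) := by
        simpa using ((ha.sub_const a).mul_const C).sqrt
      refine squeeze_zero_norm (fun k => ?_) hz
      refine Real.le_sqrt_of_sq_le ?_
      rw [Real.norm_eq_abs, sq_abs]
      exact (hcs k _ _).trans (mul_le_mul (htail k) (hC k) (hB k h) (sub_nonneg.2 (hle k)))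
    have h1 : Tendsto (fun k => inner ℝ (f - α • v k) h) atTop (𝓝 (inner ℝ (f - α • u) h)) :=
      ((hu.const_smul α).const_sub f).inner tendsto_const_nhds
    have h2 := h1.sub hdiff
    rw [sub_zero] at h2
    refine h2.congr fun k => ?_
    rw [map_sub, hBv k]
    simp only [inner_sub_left]
    ring

end MonotoneForms

end ContinuousLinearMap

/-! ### Density and uniform-boundedness arguments -/

section Approximation

variable {E : Type*} [NormedAddCommGroup E]

theorem cauchySeq_of_forall_eventually_norm_sub_le {x : ℕ → E}
    (h : ∀ ε > 0, ∃ y : ℕ → E, CauchySeq y ∧ ∀ᶠ k in atTop, ‖x k - y k‖ ≤ ε) : CauchySeq x := by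
  rw [Metric.cauchySeq_iff]
  intro ε hε
  obtain ⟨y, hy, hxy⟩ := h (ε / 4) (by positivity)
  obtain ⟨N, hN⟩ := Metric.cauchySeq_iff.1 hy (ε / 4) (by positivity)
  obtain ⟨M, hM⟩ := eventually_atTop.1 hxy
  refine ⟨max N M, fun k hk l hl => ?_⟩
  have h1 := hN k ((le_max_left _ _).trans hk) l ((le_max_left _ _).trans hl)
  have h2 := hM k ((le_max_right _ _).trans hk)
  have h3 := hM l ((le_max_right _ _).trans hl)
  rw [← dist_eq_norm] at h2 h3
  have h4 := dist_triangle4 (x k) (y k) (y l) (x l)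
  rw [dist_comm (y l)] at h4
  linarith

variable [NormedSpace ℝ E] {ι : Type*} {l : Filter ι}

/-- A strong limit of uniformly bounded operators need only be checked on a dense range. -/
theorem tendsto_apply_of_denseRange {F : Type*} [NormedAddCommGroup F] [NormedSpace ℝ F]
    {T : ι → E →L[ℝ] F} {S : E →L[ℝ] F} {C : ℝ} (hT : ∀ᶠ i in l, ∀ x, ‖T i x‖ ≤ C * ‖x‖)
    {β : Type*} {d : β → E} (hd : DenseRange d)
    (h : ∀ b, Tendsto (fun i => T i (d b)) l (𝓝 (S (d b)))) (x : E) :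
    Tendsto (fun i => T i x) l (𝓝 (S x)) := by
  -- C has no assumed sign, so it is replaced by max C 0.
  have hC : ∀ᶠ i in l, ∀ x, ‖T i x‖ ≤ max C 0 * ‖x‖ := hT.mono fun i hi x =>
    (hi x).trans (mul_le_mul_of_nonneg_right (le_max_left _ _) (norm_nonneg _))
  set C' := max C 0
  have hC' : 0 ≤ C' := le_max_right _ _
  rw [Metric.tendsto_nhds]
  intro ε hε
  have hD : 0 < C' + ‖S‖ + 1 := by positivity
  obtain ⟨b, hb⟩ := hd.exists_dist_lt x (ε := ε / 2 / (C' + ‖S‖ + 1)) (by positivity)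
  rw [dist_eq_norm, lt_div_iff₀ hD] at hb
  filter_upwards [hC, Metric.tendsto_nhds.1 (h b) (ε / 2) (by positivity)] with i hi hib
  rw [dist_eq_norm] at hib ⊢
  have h1 := hi (x - d b)
  have h2 := S.le_opNorm (x - d b)
  have h3 : T i x - S x = T i (x - d b) + (T i (d b) - S (d b)) - S (x - d b) := by
    simp only [map_sub]; abel
  have h4 : ‖T i x - S x‖ ≤ ‖T i (x - d b)‖ + ‖T i (d b) - S (d b)‖ + ‖S (x - d b)‖ := by
    rw [h3]
    exact (norm_sub_le _ _).trans (by gcongr; exact norm_add_le _ _)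
  nlinarith [norm_nonneg (x - d b)]

/-- Applying a uniformly bounded, strongly convergent net of operators to a convergent net. -/
theorem tendsto_apply_of_tendsto {F : Type*} [NormedAddCommGroup F] [NormedSpace ℝ F]
    {T : ι → E →L[ℝ] F} {C : ℝ} (hT : ∀ i x, ‖T i x‖ ≤ C * ‖x‖) {x : ι → E} {y : E} {z : F}
    (hx : Tendsto x l (𝓝 y)) (hy : Tendsto (fun i => T i y) l (𝓝 z)) :
    Tendsto (fun i => T i (x i)) l (𝓝 z) := by
  have h0 : Tendsto (fun i => T i (x i - y)) l (𝓝 0) := by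
    refine squeeze_zero_norm (fun i => hT i _) ?_
    simpa using ((hx.sub_const y).norm).const_mul C
  simpa using h0.add hy

end Approximation

/-! ### Resolvents of accretive unbounded operators -/

section Resolvent

variable {H : Type*} [NormedAddCommGroup H] [InnerProductSpace ℝ H]
  {L : H →ₗ.[ℝ] H} {α : ℝ} {R : H →L[ℝ] H}

theorem IsResolventOf.exists_domain (hR : IsResolventOf L α R) (g : H) :
    ∃ u : L.domain, (u : H) = R g ∧ L u = g - α • R g := by
  obtain ⟨u, hu, hLu⟩ := (hR (R g) g).1 rfl
  exact ⟨u, hu, by rw [← hu, ← hLu]; abel⟩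

/-- Only injectivity of L + α needs proof: L(w - u) = -α(w - u) contradicts accretivity unless w =
u. -/
theorem isResolventOf_of_accretive (hα : 0 < α)
    (hL : ∀ u : L.domain, 0 ≤ inner ℝ (L u) (u : H))
    (h : ∀ g, ∃ u : L.domain, (u : H) = R g ∧ L u = g - α • R g) : IsResolventOf L α R := by
  intro f g
  obtain ⟨w, hw, hLw⟩ := h g
  constructor
  · rintro rfl
    exact ⟨w, hw, by rw [hLw, hw]; abel⟩
  · rintro ⟨u, rfl, hu⟩
    have h1 := hL (w - u)
    have h2 : L (w - u) = -(α • ((w - u : L.domain) : H)) := by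
      rw [L.map_sub, hLw, ← hw, ← hu, AddSubgroupClass.coe_sub, smul_sub]
      abel
    rw [h2, inner_neg_left, real_inner_smul_left, real_inner_self_eq_norm_sq] at h1
    have h3 : ‖((w - u : L.domain) : H)‖ ^ 2 ≤ 0 := by nlinarith
    have h4 : ((w - u : L.domain) : H) = 0 :=
      norm_eq_zero.1 (by nlinarith [norm_nonneg ((w - u : L.domain) : H)])
    rw [AddSubgroupClass.coe_sub, sub_eq_zero] at h4
    rw [← hw, h4]

variable [CompleteSpace H]

/-- If f is orthogonal to the range, accretivity at Rf gives 0 ≤ ⟨f - αRf, Rf⟩ = -α‖Rf‖². Hence Rf =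
0 and f = (L + α)Rf = 0. -/
theorem IsResolventOf.denseRange (hR : IsResolventOf L α R) (hα : 0 < α)
    (hL : ∀ u : L.domain, 0 ≤ inner ℝ (L u) (u : H)) : DenseRange R := by
  have h : Dense (R.range : Set H) := by
    rw [Submodule.dense_iff_topologicalClosure_eq_top, Submodule.topologicalClosure_eq_top_iff,
      Submodule.eq_bot_iff]
    intro f hf
    obtain ⟨u, hu, hLu⟩ := hR.exists_domain f
    have h0 : inner ℝ (u : H) f = 0 := hu ▸ hf (R f) ⟨f, rfl⟩
    have h1 := hL u
    rw [hLu, ← hu, inner_sub_left, real_inner_smul_left, real_inner_comm, h0,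
      real_inner_self_eq_norm_sq] at h1
    have h2 : ‖(u : H)‖ = 0 := by
      have : ‖(u : H)‖ ^ 2 ≤ 0 := by nlinarith
      nlinarith [norm_nonneg (u : H)]
    have h3 : u = 0 := by
      ext
      exact norm_eq_zero.1 h2
    have h4 : R f = 0 := by rw [← hu, h3]; rfl
    rw [h3, L.map_zero, h4, smul_zero, sub_zero] at hLu
    exact hLu.symm
  exact h

end Resolvent

/-! ### Generation, uniqueness and convergence of semigroups -/

section Semigroup

variable {H : Type*} [NormedAddCommGroup H] [InnerProductSpace ℝ H]
  {L : H →ₗ.[ℝ] H} {B : ℕ → H →L[ℝ] H} {R : ℝ → H →L[ℝ] H}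

open ContinuousLinearMap

/-- If `P` is a strongly continuous contraction semigroup whose generator extends `-L`, and if
`L + 1` is onto, then the generator is `-L`. -/
theorem isSemigroupOf_of_contraction {R₁ : H →L[ℝ] H} (hR : IsResolventOf L 1 R₁)
    {P : ℝ≥0 → H →L[ℝ] H} (hzero : P 0 = 1) (hadd : ∀ s t, P (s + t) = P s * P t)
    (hcont : ∀ f, Continuous fun t => P t f) (hle : ∀ t x, ‖P t x‖ ≤ ‖x‖)
    (hgen : ∀ g, Tendsto (fun t : ℝ≥0 => (t : ℝ)⁻¹ • (P t (R₁ g) - R₁ g)) (𝓝[>] 0)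
      (𝓝 (-(g - R₁ g)))) : IsSemigroupOf L P where
  zero := hzero
  add := hadd
  continuous := hcont
  generator f g := by
    constructor
    · rintro ⟨u, rfl, rfl⟩
      have hu : R₁ (L u + (1 : ℝ) • (u : H)) = u := (hR _ _).2 ⟨u, rfl, rfl⟩
      have := hgen (L u + (1 : ℝ) • (u : H))
      rw [hu, one_smul, add_sub_cancel_right] at this
      exact this
    · intro h
      -- The generator sends w = u - f to w itself. Contractivity makes ⟨generator of w, w⟩ ≤ 0, so
      -- w = 0.
      obtain ⟨u, hu, hLu⟩ := hR.exists_domain (f + g)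
      have h1 := hgen (f + g)
      rw [← hu] at h1
      have h2 := h1.sub h
      have h3 : Tendsto (fun t : ℝ≥0 => (t : ℝ)⁻¹ • (P t ((u : H) - f) - ((u : H) - f))) (𝓝[>] 0)
          (𝓝 ((u : H) - f)) := by
        convert h2 using 2
        · rw [← smul_sub, map_sub]; congr 1; abel
        · abel
      have h4 : inner ℝ ((u : H) - f) ((u : H) - f) ≤ 0 := by
        refine le_of_tendsto (h3.inner tendsto_const_nhds) (Eventually.of_forall fun t => ?_)
        rw [real_inner_smul_left, inner_sub_left, real_inner_self_eq_norm_sq]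
        have h5 := real_inner_le_norm (P t ((u : H) - f)) ((u : H) - f)
        have h6 := hle t ((u : H) - f)
        have h7 : (0 : ℝ) ≤ (t : ℝ)⁻¹ := by positivity
        nlinarith [norm_nonneg ((u : H) - f),
          mul_le_mul_of_nonneg_right h6 (norm_nonneg ((u : H) - f))]
      have h5 : (u : H) = f := by
        rw [real_inner_self_eq_norm_sq] at h4
        exact sub_eq_zero.1 (norm_eq_zero.1 (by nlinarith [norm_nonneg ((u : H) - f)]))
      refine ⟨u, h5, ?_⟩
      rw [hLu, ← hu, h5]
      simp

/-- P s commutes with the difference quotients, so it preserves the domain and commutes with L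
there. -/
theorem IsSemigroupOf.exists_domain {P : ℝ≥0 → H →L[ℝ] H} (hP : IsSemigroupOf L P)
    (u : L.domain) (s : ℝ≥0) : ∃ v : L.domain, (v : H) = P s u ∧ L v = P s (L u) := by
  refine (hP.generator _ _).2 ?_
  have h := ((P s).continuous.tendsto _).comp ((hP.generator _ _).1 ⟨u, rfl, rfl⟩)
  rw [map_neg] at h
  refine h.congr fun t => ?_
  rw [Function.comp_apply, map_smul, map_sub, ← mul_apply_eq_comp, ← mul_apply_eq_comp,
    ← hP.add, ← hP.add, add_comm]

theorem IsSemigroupOf.hasDerivWithinAt {P : ℝ≥0 → H →L[ℝ] H} (hP : IsSemigroupOf L P)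
    (u : L.domain) {s : ℝ} (hs : 0 ≤ s) :
    HasDerivWithinAt (fun t : ℝ => P t.toNNReal u) (-(P s.toNNReal (L u))) (Set.Ici s) s := by
  obtain ⟨v, hv, hLv⟩ := hP.exists_domain u s.toNNReal
  have h := (hP.generator _ _).1 ⟨v, rfl, rfl⟩
  rw [hLv, hv] at h
  rw [← hasDerivWithinAt_Ioi_iff_Ici, hasDerivWithinAt_iff_tendsto_slope' Set.self_notMem_Ioi]
  have hmap : Tendsto (fun t : ℝ => (t - s).toNNReal) (𝓝[>] s) (𝓝[>] 0) := by
    refine tendsto_nhdsWithin_iff.2 ⟨?_, ?_⟩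
    · have : Continuous fun t : ℝ => (t - s).toNNReal := by fun_prop
      simpa using (this.tendsto s).mono_left nhdsWithin_le_nhds
    · filter_upwards [self_mem_nhdsWithin] with t ht
      exact Real.toNNReal_pos.2 (sub_pos.2 ht)
  refine (h.comp hmap).congr' ?_
  filter_upwards [self_mem_nhdsWithin] with t ht
  have hst : 0 ≤ t - s := (sub_pos.2 ht).le
  rw [Function.comp_apply, slope_def_module, Real.coe_toNNReal _ hst, ← mul_apply_eq_comp,
    ← hP.add, ← Real.toNNReal_add hst hs, sub_add_cancel]

/-- An accretive operator with dense domain generates at most one semigroup. -/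
theorem IsSemigroupOf.unique {P P' : ℝ≥0 → H →L[ℝ] H} (hP : IsSemigroupOf L P)
    (hP' : IsSemigroupOf L P') (hL : ∀ u : L.domain, 0 ≤ inner ℝ (L u) (u : H))
    (hdense : Dense (L.domain : Set H)) : P = P' := by
  have key : ∀ (u : L.domain) (t : ℝ≥0), P t u = P' t u := by
    intro u t
    have hd : ∀ s : ℝ, 0 ≤ s → HasDerivWithinAt
        (fun s : ℝ => ‖P s.toNNReal u - P' s.toNNReal u‖ ^ 2)
        (2 * inner ℝ (P s.toNNReal u - P' s.toNNReal u)
          (-(P s.toNNReal (L u)) - -(P' s.toNNReal (L u)))) (Set.Ici s) s := fun s hs =>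
      ((hP.hasDerivWithinAt u hs).sub (hP'.hasDerivWithinAt u hs)).norm_sq
    have hcont : Continuous fun s : ℝ => ‖P s.toNNReal u - P' s.toNNReal u‖ ^ 2 :=
      ((((hP.continuous u).comp continuous_real_toNNReal).sub
        ((hP'.continuous u).comp continuous_real_toNNReal)).norm).pow 2
    -- The squared distance of the two orbits starts at 0 and has right derivative -2⟨Lw, w⟩ ≤ 0 for
    -- their difference w.
    have h := image_le_of_deriv_right_le_deriv_boundary (a := 0) (b := t)
      (B := fun _ => (0 : ℝ)) (B' := fun _ => 0) hcont.continuousOn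
      (fun s hs => hd s hs.1) (by simp [hP.zero, hP'.zero]) continuousOn_const
      (fun s _ => hasDerivWithinAt_const _ _ _)
      (fun s hs => by
        obtain ⟨v, hv, hLv⟩ := hP.exists_domain u s.toNNReal
        obtain ⟨v', hv', hLv'⟩ := hP'.exists_domain u s.toNNReal
        have h1 := hL (v - v')
        rw [L.map_sub, hLv, hLv', AddSubgroupClass.coe_sub, hv, hv', real_inner_comm] at h1
        rw [neg_sub_neg, ← neg_sub (P s.toNNReal (L u)), inner_neg_right]
        linarith) (Set.right_mem_Icc.2 t.2)
    rw [Real.toNNReal_coe] at h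
    have h0 : ‖P t u - P' t u‖ = 0 := by nlinarith [norm_nonneg (P t u - P' t u)]
    exact sub_eq_zero.1 (norm_eq_zero.1 h0)
  funext t
  refine ContinuousLinearMap.ext fun x => ?_
  exact congrFun ((P t).continuous.ext_on hdense (P' t).continuous fun y hy => key ⟨y, hy⟩ t) x

variable [CompleteSpace H]

theorem norm_inverse_add_one_apply_le {A : H →L[ℝ] H} (hA : ∀ x, 0 ≤ inner ℝ (A x) x) (x : H) :
    ‖Ring.inverse (A + (1 : ℝ) • 1) x‖ ≤ ‖x‖ := by
  simpa using norm_inverse_add_smul_one_apply_le hA one_pos x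

theorem norm_apply_inverse_add_one_apply_le {A : H →L[ℝ] H} (hA : ∀ x, 0 ≤ inner ℝ (A x) x)
    (x : H) : ‖A (Ring.inverse (A + (1 : ℝ) • 1) x)‖ ≤ 2 * ‖x‖ := by
  rw [apply_inverse_add_smul_one hA one_pos, one_smul]
  refine (norm_sub_le _ _).trans ?_
  linarith [norm_inverse_add_one_apply_le hA x]

/-- The bound does not depend on A: on squared resolvents, second-order errors are uniform along a
whole sequence of operators. It comes from A(A + 1)⁻¹ = 1 - (A + 1)⁻¹, used repeatedly. -/
theorem norm_apply_apply_inverse_add_one_le {A : H →L[ℝ] H} (hA : ∀ x, 0 ≤ inner ℝ (A x) x)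
    (x : H) : ‖A (A (Ring.inverse (A + (1 : ℝ) • 1) (Ring.inverse (A + (1 : ℝ) • 1) x)))‖ ≤
      4 * ‖x‖ := by
  rw [apply_inverse_add_smul_one hA one_pos, map_sub, one_smul ℝ (Ring.inverse (A + (1 : ℝ) • 1) _)]
  refine (norm_sub_le _ _).trans ?_
  linarith [norm_apply_inverse_add_one_apply_le hA x, norm_inverse_add_one_apply_le hA x,
    norm_apply_inverse_add_one_apply_le hA (Ring.inverse (A + (1 : ℝ) • 1) x)]

theorem tendsto_inverse_inverse (hB : ∀ k x, 0 ≤ inner ℝ (B k x) x)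
    (hconv : ∀ α : ℝ, 0 < α → ∀ f, Tendsto (fun k => Ring.inverse (B k + α • 1) f) atTop (𝓝 (R α f)))
    (g : H) : Tendsto (fun k => Ring.inverse (B k + (1 : ℝ) • 1)
      (Ring.inverse (B k + (1 : ℝ) • 1) g)) atTop (𝓝 (R 1 (R 1 g))) :=
  tendsto_apply_of_tendsto (C := 1)
    (fun k x => by simpa using norm_inverse_add_one_apply_le (hB k) x)
    (hconv 1 one_pos g) (hconv 1 one_pos _)

/-- Strong convergence of the resolvents implies that the semigroups converge strongly. -/
theorem cauchySeq_exp_neg_smul_apply (hB : ∀ k x, 0 ≤ inner ℝ (B k x) x)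
    (hconv : ∀ α : ℝ, 0 < α → ∀ f, Tendsto (fun k => Ring.inverse (B k + α • 1) f) atTop (𝓝 (R α f)))
    (hdense : DenseRange (R 1)) {t : ℝ} (ht : 0 ≤ t) (f : H) :
    CauchySeq fun k => NormedSpace.exp (-t • B k) f := by
  rcases ht.eq_or_lt with rfl | ht
  · simpa using (tendsto_const_nhds (x := f)).cauchySeq
  have hdense2 : DenseRange fun g => R 1 (R 1 g) := hdense.comp hdense (R 1).continuous
  have hcore : ∀ g, CauchySeq fun k => NormedSpace.exp (-t • B k) (R 1 (R 1 g)) := by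
    intro g
    refine cauchySeq_of_forall_eventually_norm_sub_le fun ε hε => ?_
    -- This n makes the Euler error (2t²/n)·4‖g‖ less than ε/2 for every k at once.
    obtain ⟨n, hn⟩ := exists_nat_gt (2 * t ^ 2 * (4 * ‖g‖) / (ε / 2))
    have hn0 : (0 : ℝ) < n := lt_of_le_of_lt (by positivity) hn
    have hn0' : n ≠ 0 := by rintro rfl; simp at hn0
    set α : ℝ := n / t
    have hα : 0 < α := by positivity
    set V : ℕ → H →L[ℝ] H := fun k => α • Ring.inverse (B k + α • 1) with hV
    have hVle : ∀ k x, ‖V k x‖ ≤ 1 * ‖x‖ := fun k x => by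
      rw [hV, smul_apply, norm_smul, Real.norm_of_nonneg hα.le, one_mul]
      exact norm_inverse_add_smul_one_apply_le (hB k) hα x
    -- For a fixed exponent, strong convergence passes to powers because the V k are contractions.
    have hVpow : ∀ (j : ℕ) {x : ℕ → H} {y : H}, Tendsto x atTop (𝓝 y) →
        Tendsto (fun k => (V k ^ j) (x k)) atTop (𝓝 (((α • R α) ^ j) y)) := by
      intro j
      induction j with
      | zero => intro x y h; simpa using h
      | succ j ih =>
        intro x y h
        simp only [pow_succ, mul_apply_eq_comp]
        exact ih (tendsto_apply_of_tendsto hVle h ((hconv α hα y).const_smul α))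
    have hg := tendsto_inverse_inverse hB hconv g
    refine ⟨_, (hVpow n hg).cauchySeq, ?_⟩
    have hsmall := Metric.tendsto_nhds.1 hg (ε / 2) (by positivity)
    filter_upwards [hsmall] with k hk
    -- Euler's bound needs a squared resolvent of B k itself, so R 1 (R 1 g) is exchanged for w at a
    -- cost of ε/2.
    set w := Ring.inverse (B k + (1 : ℝ) • 1) (Ring.inverse (B k + (1 : ℝ) • 1) g) with hw
    rw [dist_eq_norm, norm_sub_rev] at hk
    have h1 : ‖NormedSpace.exp (-t • B k) (R 1 (R 1 g) - w)‖ ≤ ‖R 1 (R 1 g) - w‖ :=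
      norm_exp_neg_smul_apply_le (hB k) ht.le _
    have h2 : ‖NormedSpace.exp (-t • B k) w - (V k ^ n) w‖ ≤ 2 * t ^ 2 / n * ‖B k (B k w)‖ :=
      norm_exp_neg_smul_apply_sub_pow_le (hB k) ht hn0' w
    have h3 : ‖B k (B k w)‖ ≤ 4 * ‖g‖ := norm_apply_apply_inverse_add_one_le (hB k) g
    have h4 : 2 * t ^ 2 / n * ‖B k (B k w)‖ ≤ ε / 2 := by
      calc _ ≤ 2 * t ^ 2 / n * (4 * ‖g‖) := by gcongr
        _ = 2 * t ^ 2 * (4 * ‖g‖) / n := by ring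
        _ ≤ ε / 2 := by
          rw [div_lt_iff₀ (by positivity)] at hn
          rw [div_le_iff₀ hn0]
          linarith
    have h5 : NormedSpace.exp (-t • B k) (R 1 (R 1 g)) - (V k ^ n) w =
        NormedSpace.exp (-t • B k) (R 1 (R 1 g) - w) +
          (NormedSpace.exp (-t • B k) w - (V k ^ n) w) := by
      rw [map_sub]; abel
    rw [h5]
    refine (norm_add_le _ _).trans ?_
    linarith
  refine cauchySeq_of_forall_eventually_norm_sub_le fun ε hε => ?_
  obtain ⟨g, hg⟩ := hdense2.exists_dist_lt f hε
  refine ⟨_, hcore g, Eventually.of_forall fun k => ?_⟩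
  rw [← map_sub]
  rw [dist_eq_norm] at hg
  exact (norm_exp_neg_smul_apply_le (hB k) ht.le _).trans hg.le

/-- If the resolvents of bounded accretive operators converge strongly to the resolvents of the
accretive operator `L`, then `-L` generates a semigroup, the strong limit of the semigroups of the
bounded operators. -/
theorem exists_isSemigroupOf_tendsto (hL : ∀ u : L.domain, 0 ≤ inner ℝ (L u) (u : H))
    (hR : IsResolventOf L 1 (R 1)) (hB : ∀ k x, 0 ≤ inner ℝ (B k x) x)
    (hconv : ∀ α : ℝ, 0 < α → ∀ f, Tendsto (fun k => Ring.inverse (B k + α • 1) f) atTop (𝓝 (R α f))) :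
    ∃ P : ℝ≥0 → H →L[ℝ] H, IsSemigroupOf L P ∧ ∀ (t : ℝ≥0) (f : H),
      Tendsto (fun k => NormedSpace.exp (-(t : ℝ) • B k) f) atTop (𝓝 (P t f)) := by
  have hdense := hR.denseRange one_pos hL
  choose p hp using fun (t : ℝ≥0) (f : H) =>
    cauchySeq_tendsto_of_complete (cauchySeq_exp_neg_smul_apply hB hconv hdense t.2 f)
  set P : ℝ≥0 → H →L[ℝ] H := fun t =>
    continuousLinearMapOfTendsto (fun k => NormedSpace.exp (-(t : ℝ) • B k))
      (tendsto_pi_nhds.2 (hp t)) with hP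
  have hPt : ∀ (t : ℝ≥0) (f : H),
      Tendsto (fun k => NormedSpace.exp (-(t : ℝ) • B k) f) atTop (𝓝 (P t f)) := hp
  have hexp : ∀ (t : ℝ≥0) k x, ‖NormedSpace.exp (-(t : ℝ) • B k) x‖ ≤ ‖x‖ := fun t k x =>
    norm_exp_neg_smul_apply_le (hB k) t.2 x
  have hle : ∀ t x, ‖P t x‖ ≤ ‖x‖ := fun t x =>
    le_of_tendsto (hPt t x).norm (Eventually.of_forall fun k => hexp t k x)
  have hzero : P 0 = 1 := by
    ext f
    refine tendsto_nhds_unique (hPt 0 f) ?_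
    simp
  have hadd : ∀ s t, P (s + t) = P s * P t := by
    intro s t
    ext f
    refine tendsto_nhds_unique (hPt (s + t) f) ?_
    simp only [NNReal.coe_add, exp_neg_add_smul, mul_apply_eq_comp]
    exact tendsto_apply_of_tendsto (C := 1) (fun k x => by simpa using hexp s k x) (hPt t f)
      (hPt s _)
  have happ : ∀ (t : ℝ≥0) {x : ℕ → H} {y : H}, Tendsto x atTop (𝓝 y) →
      Tendsto (fun k => NormedSpace.exp (-(t : ℝ) • B k) (x k)) atTop (𝓝 (P t y)) :=
    fun t x y h => tendsto_apply_of_tendsto (C := 1) (fun k x => by simpa using hexp t k x) h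
      (hPt t y)
  -- First- and second-order bounds for e^{-tB_k} on resolvents are uniform in k and survive the
  -- limit. In `htaylor`, R 1 g - R 1 (R 1 g) plays the role of L applied to R 1 (R 1 g).
  have hlip : ∀ (t : ℝ≥0) g, ‖P t (R 1 g) - R 1 g‖ ≤ t * (2 * ‖g‖) := by
    intro t g
    have h1 := hconv 1 one_pos g
    refine le_of_tendsto ((happ t h1).sub h1).norm (Eventually.of_forall fun k => ?_)
    exact (norm_exp_neg_smul_apply_sub_le (hB k) t.2 _).trans
      (mul_le_mul_of_nonneg_left (norm_apply_inverse_add_one_apply_le (hB k) g) t.2)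
  have htaylor : ∀ (t : ℝ≥0) g, ‖P t (R 1 (R 1 g)) - R 1 (R 1 g) +
      (t : ℝ) • (R 1 g - R 1 (R 1 g))‖ ≤ (t : ℝ) ^ 2 * (4 * ‖g‖) := by
    intro t g
    have h1 := hconv 1 one_pos g
    have h2 := tendsto_inverse_inverse hB hconv g
    refine le_of_tendsto (((happ t h2).sub h2).add ((h1.sub h2).const_smul (t : ℝ))).norm
      (Eventually.of_forall fun k => ?_)
    have h3 := norm_exp_neg_smul_apply_sub_add_le (hB k) t.2
      (Ring.inverse (B k + (1 : ℝ) • 1) (Ring.inverse (B k + (1 : ℝ) • 1) g))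
    have h4 := mul_le_mul_of_nonneg_left (norm_apply_apply_inverse_add_one_le (hB k) g)
      (sq_nonneg (t : ℝ))
    refine le_trans (le_of_eq ?_) (h3.trans h4)
    rw [apply_inverse_add_smul_one (hB k) one_pos (Ring.inverse (B k + (1 : ℝ) • 1) g),
      one_smul ℝ (Ring.inverse (B k + (1 : ℝ) • 1) (Ring.inverse (B k + (1 : ℝ) • 1) g))]
    rfl
  have hcont : ∀ f, Continuous fun t => P t f := by
    intro f
    refine continuous_iff_continuousAt.2 fun s => ?_
    refine tendsto_apply_of_denseRange (C := 1) (T := P) (S := P s)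
      (Eventually.of_forall fun t x => by simpa using hle t x) hdense (fun g => ?_) f
    have hlt : ∀ a b : ℝ≥0, a ≤ b →
        ‖P b (R 1 g) - P a (R 1 g)‖ ≤ ((b : ℝ) - a) * (2 * ‖g‖) := by
      intro a b hab
      have h1 : P b (R 1 g) - P a (R 1 g) = P a (P (b - a) (R 1 g) - R 1 g) := by
        rw [map_sub, ← mul_apply_eq_comp (P a) (P (b - a)), ← hadd, add_tsub_cancel_of_le hab]
      rw [h1, ← NNReal.coe_sub hab]
      exact (hle _ _).trans (hlip _ _)
    rw [tendsto_iff_norm_sub_tendsto_zero]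
    have hz : Tendsto (fun t : ℝ≥0 => |(t : ℝ) - s| * (2 * ‖g‖)) (𝓝 s) (𝓝 0) := by
      have : Continuous fun t : ℝ≥0 => |(t : ℝ) - s| * (2 * ‖g‖) := by fun_prop
      simpa using this.tendsto s
    refine squeeze_zero (fun _ => norm_nonneg _) (fun t => ?_) hz
    rcases le_total s t with hst | hst
    · rw [abs_of_nonneg (sub_nonneg.2 (NNReal.coe_le_coe.2 hst))]
      exact hlt s t hst
    · rw [norm_sub_rev, abs_sub_comm, abs_of_nonneg (sub_nonneg.2 (NNReal.coe_le_coe.2 hst))]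
      exact hlt t s hst
  refine ⟨P, isSemigroupOf_of_contraction hR hzero hadd hcont hle fun g => ?_, hPt⟩
  have hpos : ∀ᶠ t : ℝ≥0 in 𝓝[>] 0, (0 : ℝ) < t := by
    filter_upwards [self_mem_nhdsWithin] with t ht using NNReal.coe_pos.2 ht
  -- By `hlip` the difference quotients composed with R 1 are bounded by 2, so the limit need only
  -- be checked on the dense range of R 1, where `htaylor` gives it.
  refine tendsto_apply_of_denseRange (C := 2)
    (T := fun t : ℝ≥0 => (t : ℝ)⁻¹ • (P t * R 1 - R 1)) (S := -(1 - R 1)) ?_ hdense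
    (fun g => ?_) g
  · filter_upwards [hpos] with t ht x
    change ‖(t : ℝ)⁻¹ • (P t (R 1 x) - R 1 x)‖ ≤ _
    rw [norm_smul, norm_inv, Real.norm_of_nonneg ht.le, inv_mul_le_iff₀ ht]
    exact hlip t x
  · change Tendsto (fun t : ℝ≥0 => (t : ℝ)⁻¹ • (P t (R 1 (R 1 g)) - R 1 (R 1 g))) (𝓝[>] 0)
      (𝓝 (-(R 1 g - R 1 (R 1 g))))
    rw [tendsto_iff_norm_sub_tendsto_zero]
    have hz : Tendsto (fun t : ℝ≥0 => (t : ℝ) * (4 * ‖g‖)) (𝓝[>] 0) (𝓝 0) := by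
      have : Continuous fun t : ℝ≥0 => (t : ℝ) * (4 * ‖g‖) := by fun_prop
      simpa using (this.tendsto 0).mono_left nhdsWithin_le_nhds
    refine squeeze_zero' (Eventually.of_forall fun _ => norm_nonneg _) ?_ hz
    filter_upwards [hpos] with t ht
    have h1 : (t : ℝ)⁻¹ • (P t (R 1 (R 1 g)) - R 1 (R 1 g)) - -(R 1 g - R 1 (R 1 g)) =
        (t : ℝ)⁻¹ • (P t (R 1 (R 1 g)) - R 1 (R 1 g) + (t : ℝ) • (R 1 g - R 1 (R 1 g))) := by
      rw [smul_add, inv_smul_smul₀ ht.ne', sub_neg_eq_add]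
    rw [h1, norm_smul, norm_inv, Real.norm_of_nonneg ht.le, inv_mul_le_iff₀ ht]
    refine (htaylor t g).trans (le_of_eq ?_)
    ring

end Semigroup

/-! ### Functional calculus across an intertwining map -/

section Intertwining

variable {V H : Type*} [NormedAddCommGroup V] [InnerProductSpace ℝ V] [CompleteSpace V]
  [NormedAddCommGroup H] [InnerProductSpace ℝ H] [CompleteSpace H]
  {A : V →L[ℝ] V} {B : H →L[ℝ] H} {J : V →L[ℝ] H}

theorem exp_apply_of_intertwining (h : ∀ x, B (J x) = J (A x)) (x : V) :
    NormedSpace.exp B (J x) = J (NormedSpace.exp A x) := by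
  have hpow : ∀ (n : ℕ) (x : V), (B ^ n) (J x) = J ((A ^ n) x) := by
    intro n
    induction n with
    | zero => intro x; rfl
    | succ n ih => intro x; rw [pow_succ, pow_succ, mul_apply_eq_comp, mul_apply_eq_comp, h, ih]
  have h1 := (ContinuousLinearMap.apply ℝ H (J x)).hasSum
    (NormedSpace.exp_series_hasSum_exp' (𝕂 := ℝ) B)
  have h2 := (J.comp (ContinuousLinearMap.apply ℝ V x)).hasSum
    (NormedSpace.exp_series_hasSum_exp' (𝕂 := ℝ) A)
  refine h1.unique (h2.congr_fun ?_)
  intro n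
  change ((n.factorial : ℝ)⁻¹ • B ^ n) (J x) = J (((n.factorial : ℝ)⁻¹ • A ^ n) x)
  rw [smul_apply, smul_apply, map_smul, hpow]

theorem inverse_apply_of_intertwining (h : ∀ x, B (J x) = J (A x))
    (hA : ∀ x, 0 ≤ inner ℝ (A x) x) (hB : ∀ x, 0 ≤ inner ℝ (B x) x) {α : ℝ} (hα : 0 < α) (x : V) :
    Ring.inverse (B + α • 1) (J x) = J (Ring.inverse (A + α • 1) x) := by
  have h1 : J x = B (J (Ring.inverse (A + α • 1) x)) + α • J (Ring.inverse (A + α • 1) x) := by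
    rw [h, ContinuousLinearMap.apply_inverse_add_smul_one hA hα, map_sub, map_smul]
    abel
  rw [h1, ContinuousLinearMap.inverse_add_smul_one_apply hB hα]

end Intertwining

/-! ### Energy on finite vertex sets and along an exhaustion -/

namespace WeightedGraph

variable {X : Type*} {G : WeightedGraph X}

theorem edge_term_nonneg (G : WeightedGraph X) (f : X → ℝ) (p : X × X) :
    0 ≤ G.b p.1 p.2 * (f p.1 - f p.2) * (f p.1 - f p.2) := by
  rw [mul_assoc]; exact mul_nonneg (G.b_nonneg _ _) (mul_self_nonneg _)

theorem killing_term_nonneg (G : WeightedGraph X) (f : X → ℝ) (x : X) :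
    0 ≤ G.c x * f x * f x := by
  rw [mul_assoc]; exact mul_nonneg (G.c_nonneg _) (mul_self_nonneg _)

theorem energy_self_nonneg (G : WeightedGraph X) (f : X → ℝ) : 0 ≤ G.energy f f :=
  add_nonneg (mul_nonneg (by norm_num) (tsum_nonneg (G.edge_term_nonneg f)))
    (tsum_nonneg (G.killing_term_nonneg f))

/-- The part of the energy form that lives on a finite set of vertices. -/
noncomputable def partialEnergy (G : WeightedGraph X) (S : Finset X) (f g : X → ℝ) : ℝ :=
  1 / 2 * ∑ p ∈ S ×ˢ S, G.b p.1 p.2 * (f p.1 - f p.2) * (g p.1 - g p.2) +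
    ∑ x ∈ S, G.c x * f x * g x

theorem partialEnergy_self_nonneg (G : WeightedGraph X) (S : Finset X) (f : X → ℝ) :
    0 ≤ G.partialEnergy S f f :=
  add_nonneg (mul_nonneg (by norm_num) (Finset.sum_nonneg fun p _ => G.edge_term_nonneg f p))
    (Finset.sum_nonneg fun x _ => G.killing_term_nonneg f x)

theorem partialEnergy_self_mono (G : WeightedGraph X) {S T : Finset X} (h : S ⊆ T) (f : X → ℝ) :
    G.partialEnergy S f f ≤ G.partialEnergy T f f := by
  unfold partialEnergy
  have h1 := Finset.sum_le_sum_of_subset_of_nonneg (Finset.product_subset_product h h)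
    fun p _ _ => G.edge_term_nonneg f p
  have h2 := Finset.sum_le_sum_of_subset_of_nonneg h fun x _ _ => G.killing_term_nonneg f x
  linarith

theorem partialEnergy_comm (G : WeightedGraph X) (S : Finset X) (f g : X → ℝ) :
    G.partialEnergy S f g = G.partialEnergy S g f := by
  unfold partialEnergy
  congr 2
  · exact Finset.sum_congr rfl fun p _ => by ring
  · exact funext fun x => by ring

section Exhaustion

variable {K : ℕ → Finset X}

theorem IsExhaustion.monotone (hK : G.IsExhaustion K) : Monotone K :=
  monotone_nat_of_le_succ hK.subset_succ

theorem IsExhaustion.tendsto_atTop (hK : G.IsExhaustion K) : Tendsto K atTop atTop :=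
  tendsto_atTop_finset_of_monotone hK.monotone hK.exists_mem

theorem IsExhaustion.tendsto_product_atTop (hK : G.IsExhaustion K) :
    Tendsto (fun k => K k ×ˢ K k) atTop atTop := by
  refine tendsto_atTop_finset_of_monotone
    (fun k l h => Finset.product_subset_product (hK.monotone h) (hK.monotone h)) fun p => ?_
  obtain ⟨k, hk⟩ := hK.exists_mem p.1
  obtain ⟨l, hl⟩ := hK.exists_mem p.2
  exact ⟨max k l, Finset.mem_product.2
    ⟨hK.monotone (le_max_left k l) hk, hK.monotone (le_max_right k l) hl⟩⟩

theorem IsExhaustion.tendsto_partialEnergy (hK : G.IsExhaustion K) {f g : X → ℝ}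
    (hf : G.FiniteEnergy f) (hg : G.FiniteEnergy g) :
    Tendsto (fun k => G.partialEnergy (K k) f g) atTop (𝓝 (G.energy f g)) :=
  (((hf.summable_edge hg).hasSum.comp hK.tendsto_product_atTop).const_mul (1 / 2)).add
    ((hf.summable_killing hg).hasSum.comp hK.tendsto_atTop)

/-- All terms are nonnegative and every finite set lies in some K k. This identifies the form domain
with the boundedness condition of the monotone convergence theorem. -/
theorem IsExhaustion.finiteEnergy_iff (hK : G.IsExhaustion K) {f : X → ℝ} :
    G.FiniteEnergy f ↔ ∃ C, ∀ k, G.partialEnergy (K k) f f ≤ C := by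
  constructor
  · intro hf
    refine ⟨G.energy f f, fun k => ?_⟩
    exact Monotone.ge_of_tendsto (fun k l h => G.partialEnergy_self_mono (hK.monotone h) f)
      (hK.tendsto_partialEnergy hf hf) k
  · rintro ⟨C, hC⟩
    have h1 : ∀ k, 0 ≤ ∑ p ∈ K k ×ˢ K k, G.b p.1 p.2 * (f p.1 - f p.2) * (f p.1 - f p.2) :=
      fun k => Finset.sum_nonneg fun p _ => G.edge_term_nonneg f p
    have h2 : ∀ k, 0 ≤ ∑ x ∈ K k, G.c x * f x * f x :=
      fun k => Finset.sum_nonneg fun x _ => G.killing_term_nonneg f x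
    constructor
    · have h : Summable fun p : X × X => G.b p.1 p.2 * (f p.1 - f p.2) * (f p.1 - f p.2) := by
        refine summable_of_sum_le (c := 2 * C) (G.edge_term_nonneg f) fun s => ?_
        obtain ⟨k, hk⟩ := (hK.tendsto_product_atTop.eventually_ge_atTop s).exists
        refine (Finset.sum_le_sum_of_subset_of_nonneg hk
          fun p _ _ => G.edge_term_nonneg f p).trans ?_
        have := hC k
        have := h2 k
        unfold partialEnergy at *
        linarith
      exact h.congr fun p => by ring
    · have h : Summable fun x => G.c x * f x * f x := by
        refine summable_of_sum_le (c := C) (G.killing_term_nonneg f) fun s => ?_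
        obtain ⟨k, hk⟩ := (hK.tendsto_atTop.eventually_ge_atTop s).exists
        refine (Finset.sum_le_sum_of_subset_of_nonneg hk
          fun x _ _ => G.killing_term_nonneg f x).trans ?_
        have := hC k
        have := h1 k
        unfold partialEnergy at *
        linarith
      exact h.congr fun x => by ring

end Exhaustion

/-! ### Restriction, extension by zero and the transferred Laplacians on ℓ² -/

variable [MeasurableSpace X] [DiscreteMeasurableSpace X]

theorem hasSum_inner (f g : G.Ell2) : HasSum (fun x => G.m x * (f x * g x)) (inner ℝ f g) := by
  have hi : Integrable (fun x => inner ℝ (f x) (g x)) G.measure := L2.integrable_inner f g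
  have h := hasSum_integral_measure hi
  rw [L2.inner_def]
  refine h.congr_fun fun x => ?_
  rw [integral_smul_measure, integral_dirac, ENNReal.toReal_ofReal (G.m_pos x).le]
  simp [mul_comm]

theorem inner_eq_sum {V : Type*} [Fintype V] [MeasurableSpace V] [DiscreteMeasurableSpace V]
    {G : WeightedGraph V} (f g : G.Ell2) : inner ℝ f g = ∑ x, G.m x * (f x * g x) :=
  (hasSum_inner f g).unique (hasSum_fintype _)

theorem inner_finiteLaplacian {V : Type*} [Fintype V] [MeasurableSpace V]
    [DiscreteMeasurableSpace V] {G : WeightedGraph V} (u v : G.Ell2) :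
    inner ℝ (G.finiteLaplacian u) v =
      1 / 2 * ∑ x, ∑ y, G.b x y * (u x - u y) * (v x - v y) + ∑ x, G.c x * u x * v x := by
  have hL : ⇑(G.finiteLaplacian u) = G.finiteLaplacianFun u :=
    G.ell2EquivFun.apply_symm_apply _
  have h1 : inner ℝ (G.finiteLaplacian u) v =
      ∑ x, ∑ y, G.b x y * (u x - u y) * v x + ∑ x, G.c x * u x * v x := by
    rw [inner_eq_sum, ← Finset.sum_add_distrib]
    refine Finset.sum_congr rfl fun x _ => ?_
    rw [hL, ← Finset.sum_mul]
    change G.m x * ((1 / G.m x * ∑ y, G.b x y * (u x - u y) + G.c x / G.m x * u x) * v x) = _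
    have := (G.m_pos x).ne'
    field_simp
  -- Green's formula: exchanging x and y flips the sign of u x - u y and fixes b.
  have h2 : ∑ x, ∑ y, G.b x y * (u x - u y) * v y =
      -∑ x, ∑ y, G.b x y * (u x - u y) * v x := by
    rw [Finset.sum_comm, ← Finset.sum_neg_distrib]
    refine Finset.sum_congr rfl fun x _ => ?_
    rw [← Finset.sum_neg_distrib]
    refine Finset.sum_congr rfl fun y _ => ?_
    rw [G.b_symm y x]
    ring
  have h3 : ∑ x, ∑ y, G.b x y * (u x - u y) * (v x - v y) =
      ∑ x, ∑ y, G.b x y * (u x - u y) * v x - ∑ x, ∑ y, G.b x y * (u x - u y) * v y := by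
    simp only [mul_sub, Finset.sum_sub_distrib]
  rw [h1, h3, h2]
  ring

theorem coe_restrict (G : WeightedGraph X) (S : Finset X) (f : G.Ell2) (x : S) :
    G.restrict S f x = f x :=
  congrFun ((G.induce S).ell2EquivFun.apply_symm_apply fun x : S => f x) x

open Classical in
theorem coe_extendByZero_of_mem (G : WeightedGraph X) (S : Finset X) (u : (G.induce S).Ell2)
    (x : S) : G.extendByZero S u x = u x := by
  have h := congrFun (G.coe_toLp (G.memLp_of_finset S
    (f := fun x => if h : x ∈ S then u ⟨x, h⟩ else 0) fun x hx => dif_neg hx)) x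
  exact h.trans (dif_pos x.2)

open Classical in
theorem coe_extendByZero_of_notMem (G : WeightedGraph X) (S : Finset X) (u : (G.induce S).Ell2)
    {x : X} (hx : x ∉ S) : G.extendByZero S u x = 0 := by
  have h := congrFun (G.coe_toLp (G.memLp_of_finset S
    (f := fun x => if h : x ∈ S then u ⟨x, h⟩ else 0) fun x hx => dif_neg hx)) x
  exact h.trans (dif_neg hx)

theorem inner_extendByZero (G : WeightedGraph X) (S : Finset X) (u : (G.induce S).Ell2)
    (f : G.Ell2) : inner ℝ (G.extendByZero S u) f = inner ℝ u (G.restrict S f) := by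
  rw [inner_eq_sum u]
  have h := (hasSum_inner (G.extendByZero S u) f).unique
    (hasSum_sum_of_ne_finset_zero (s := S) fun x hx => by
      rw [G.coe_extendByZero_of_notMem S u hx, zero_mul, mul_zero])
  rw [h, ← Finset.sum_coe_sort]
  refine Finset.sum_congr rfl fun x _ => ?_
  rw [coe_extendByZero_of_mem, coe_restrict]
  rfl

theorem restrict_extendByZero (G : WeightedGraph X) (S : Finset X) (u : (G.induce S).Ell2) :
    G.restrict S (G.extendByZero S u) = u :=
  ell2_ext (funext fun x => by rw [coe_restrict, coe_extendByZero_of_mem])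

/-- Extension by zero as a bounded operator. -/
noncomputable def extension (G : WeightedGraph X) (S : Finset X) :
    (G.induce S).Ell2 →L[ℝ] G.Ell2 :=
  LinearMap.toContinuousLinearMap (G.extendByZero S)

theorem adjoint_extension_apply (G : WeightedGraph X) (S : Finset X) (f : G.Ell2) :
    (G.extension S).adjoint f = G.restrict S f := by
  refine ext_inner_left ℝ fun u => ?_
  rw [ContinuousLinearMap.adjoint_inner_right]
  exact G.inner_extendByZero S u f

theorem inner_restrict_self (G : WeightedGraph X) (S : Finset X) (f : G.Ell2) :
    inner ℝ (G.restrict S f) (G.restrict S f) = ∑ x ∈ S, G.m x * (f x * f x) := by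
  rw [inner_eq_sum (G.restrict S f), ← Finset.sum_coe_sort S fun x => G.m x * (f x * f x)]
  refine Finset.sum_congr rfl fun x _ => ?_
  rw [coe_restrict]
  rfl

theorem IsExhaustion.tendsto_extendByZero_restrict {K : ℕ → Finset X} (hK : G.IsExhaustion K)
    (f : G.Ell2) :
    Tendsto (fun k => G.extendByZero (K k) (G.restrict (K k) f)) atTop (𝓝 f) := by
  rw [tendsto_iff_norm_sub_tendsto_zero]
  -- Extension after restriction is an orthogonal projection, so the squared error is ‖f‖² minus the
  -- squared norm of the restriction: a tail of the series for ‖f‖².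
  have hsq : ∀ k, ‖G.extendByZero (K k) (G.restrict (K k) f) - f‖ =
      √(inner ℝ f f - ∑ x ∈ K k, G.m x * (f x * f x)) := fun k => by
    rw [← inner_restrict_self, norm_eq_sqrt_real_inner]
    congr 1
    simp only [inner_sub_left, inner_sub_right]
    rw [real_inner_comm _ f]
    simp only [inner_extendByZero, restrict_extendByZero]
    ring
  simp only [hsq]
  simpa using (((hasSum_inner f f).comp hK.tendsto_atTop).const_sub (inner ℝ f f)).sqrt

/-- The Laplacian of the graph induced on `S`, as a bounded operator on the whole of `ℓ²`. -/
noncomputable def extendedLaplacian (G : WeightedGraph X) (S : Finset X) : G.Ell2 →L[ℝ] G.Ell2 :=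
  G.extension S ∘L G.restrictedLaplacian S ∘L (G.extension S).adjoint

theorem inner_restrictedLaplacian_restrict (G : WeightedGraph X) (S : Finset X) (f g : G.Ell2) :
    inner ℝ (G.restrictedLaplacian S (G.restrict S f)) (G.restrict S g) =
      G.partialEnergy S f g := by
  rw [restrictedLaplacian, inner_finiteLaplacian, partialEnergy, Finset.sum_product]
  simp only [coe_restrict]
  rw [← Finset.sum_coe_sort S (fun x => G.c x * f x * g x), ← Finset.sum_coe_sort S]
  congr 2
  refine Finset.sum_congr rfl fun x _ => ?_
  rw [← Finset.sum_coe_sort S]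
  rfl

theorem inner_extendedLaplacian (G : WeightedGraph X) (S : Finset X) (f g : G.Ell2) :
    inner ℝ (G.extendedLaplacian S f) g = G.partialEnergy S f g := by
  rw [← inner_restrictedLaplacian_restrict, ← adjoint_extension_apply, ← adjoint_extension_apply,
    ContinuousLinearMap.adjoint_inner_right]
  rfl

theorem extendedLaplacian_nonneg (G : WeightedGraph X) (S : Finset X) (f : G.Ell2) :
    0 ≤ inner ℝ (G.extendedLaplacian S f) f := by
  rw [inner_extendedLaplacian]
  exact G.partialEnergy_self_nonneg S f

theorem restrictedLaplacian_nonneg (G : WeightedGraph X) (S : Finset X)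
    (u : (G.induce S).Ell2) : 0 ≤ inner ℝ (G.restrictedLaplacian S u) u := by
  rw [← G.restrict_extendByZero S u, inner_restrictedLaplacian_restrict]
  exact G.partialEnergy_self_nonneg S _

theorem extendedLaplacian_extension (G : WeightedGraph X) (S : Finset X)
    (u : (G.induce S).Ell2) :
    G.extendedLaplacian S (G.extension S u) = G.extension S (G.restrictedLaplacian S u) := by
  change G.extension S (G.restrictedLaplacian S ((G.extension S).adjoint (G.extension S u))) = _
  rw [adjoint_extension_apply]
  exact congrArg (fun v => G.extension S (G.restrictedLaplacian S v)) (G.restrict_extendByZero S u)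

/-- The cut-off of f must stay: off S the extended Laplacian is 0, so its resolvent is
multiplication by α⁻¹ there, whereas the restricted resolvent gives 0. -/
theorem restrictedResolvent_apply (G : WeightedGraph X) (S : Finset X) {α : ℝ} (hα : 0 < α)
    (f : G.Ell2) : G.restrictedResolvent S α f =
      Ring.inverse (G.extendedLaplacian S + α • 1) (G.extendByZero S (G.restrict S f)) :=
  (inverse_apply_of_intertwining (G.extendedLaplacian_extension S)
    (G.restrictedLaplacian_nonneg S) (G.extendedLaplacian_nonneg S) hα _).symm

theorem restrictedSemigroup_apply (G : WeightedGraph X) (S : Finset X) (t : ℝ≥0)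
    (f : G.Ell2) : G.restrictedSemigroup S t f =
      NormedSpace.exp (-(t : ℝ) • G.extendedLaplacian S) (G.extendByZero S (G.restrict S f)) := by
  refine (exp_apply_of_intertwining (J := G.extension S)
    (A := -(t : ℝ) • G.restrictedLaplacian S) (fun u => ?_) (G.restrict S f)).symm
  rw [smul_apply, smul_apply, map_smul, extendedLaplacian_extension]

theorem exists_neumannLaplacian_iff {f g : G.Ell2} :
    (∃ u : G.neumannLaplacian.domain, (u : G.Ell2) = f ∧ G.neumannLaplacian u = g) ↔
      G.FiniteEnergy f ∧ ∀ h : G.Ell2, G.FiniteEnergy h → G.energy f h = inner ℝ g h := by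
  have h : (f, g) ∈ G.neumannLaplacian.graph ↔ (f, g) ∈ G.neumannLaplacianGraph := by
    rw [graph_neumannLaplacian]
  exact (LinearPMap.mem_graph_iff _).symm.trans h

theorem neumannLaplacian_nonneg (G : WeightedGraph X) (u : G.neumannLaplacian.domain) :
    0 ≤ inner ℝ (G.neumannLaplacian u) (u : G.Ell2) := by
  obtain ⟨h1, h2⟩ := exists_neumannLaplacian_iff.1 ⟨u, rfl, rfl⟩
  rw [← h2 u h1]
  exact G.energy_self_nonneg _

theorem IsExhaustion.exists_isResolventOf {K : ℕ → Finset X} (hK : G.IsExhaustion K) {α : ℝ}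
    (hα : 0 < α) : ∃ R, IsResolventOf G.neumannLaplacian α R ∧ ∀ f,
      Tendsto (fun k => Ring.inverse (G.extendedLaplacian (K k) + α • 1) f) atTop (𝓝 (R f)) := by
  have hmain := ContinuousLinearMap.exists_tendsto_inverse_add_smul_one
    (B := fun k => G.extendedLaplacian (K k))
    (fun k f g => by
      rw [inner_extendedLaplacian, real_inner_comm, inner_extendedLaplacian, partialEnergy_comm])
    (fun k => G.extendedLaplacian_nonneg (K k))
    (fun f k l hkl => by
      simp only [inner_extendedLaplacian]
      exact G.partialEnergy_self_mono (hK.monotone hkl) f) hα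
  simp only [inner_extendedLaplacian, ← hK.finiteEnergy_iff] at hmain
  choose u hu huE huL using hmain
  refine ⟨continuousLinearMapOfTendsto _ (tendsto_pi_nhds.2 hu), ?_, hu⟩
  refine isResolventOf_of_accretive hα G.neumannLaplacian_nonneg fun g => ?_
  refine exists_neumannLaplacian_iff.2 ⟨huE g, fun h hh => ?_⟩
  -- The partial energies of the limit and h converge both to the full energy and to ⟨g - αu, h⟩,
  -- which is the weak equation defining L.
  exact tendsto_nhds_unique (hK.tendsto_partialEnergy (huE g) hh) (huL g h hh)

end WeightedGraph

/-! ### Strong convergence of the Neumann resolvents and semigroups -/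

theorem mainTheorem1 {X : Type*} [Countable X] [MeasurableSpace X] [DiscreteMeasurableSpace X]
    (G : WeightedGraph X) (hG : G.Connected) (K : ℕ → Finset X) (hK : G.IsExhaustion K) :
    -- the resolvents exist, and they converge strongly
    (∀ α : ℝ, 0 < α →
      IsResolventOf G.neumannLaplacian α (G.neumannResolvent α) ∧
      (∀ k, IsUnit (G.restrictedLaplacian (K k) + α • 1)) ∧
      ∀ f : G.Ell2, Tendsto (fun k => G.restrictedResolvent (K k) α f) atTop
        (𝓝 (G.neumannResolvent α f))) ∧
    -- the Neumann semigroup exists, and the restricted semigroups converge strongly to it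
    (IsSemigroupOf G.neumannLaplacian G.neumannSemigroup ∧
      ∀ (t : ℝ≥0) (f : G.Ell2), Tendsto (fun k => G.restrictedSemigroup (K k) t f) atTop
        (𝓝 (G.neumannSemigroup t f))) := by
  have hres : ∀ α : ℝ, 0 < α → IsResolventOf G.neumannLaplacian α (G.neumannResolvent α) := by
    intro α hα
    obtain ⟨R, hR, -⟩ := hK.exists_isResolventOf hα
    rw [WeightedGraph.neumannResolvent, dif_pos ⟨R, hR⟩]
    exact Exists.choose_spec (⟨R, hR⟩ : ∃ R, IsResolventOf G.neumannLaplacian α R)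
  have hconv : ∀ α : ℝ, 0 < α → ∀ f, Tendsto
      (fun k => Ring.inverse (G.extendedLaplacian (K k) + α • 1) f) atTop
      (𝓝 (G.neumannResolvent α f)) := by
    intro α hα f
    obtain ⟨R, hR, hRf⟩ := hK.exists_isResolventOf hα
    -- `neumannResolvent` is a choice, identified with the limit R by uniqueness of resolvents;
    -- `hPeq` does the same for semigroups.
    have : R f = G.neumannResolvent α f := (hR _ _).2 ((hres α hα _ _).1 rfl)
    rw [← this]
    exact hRf f
  have hpos := fun k => G.extendedLaplacian_nonneg (K k)
  obtain ⟨P, hP, hPconv⟩ :=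
    exists_isSemigroupOf_tendsto G.neumannLaplacian_nonneg (hres 1 one_pos) hpos hconv
  have hsg : IsSemigroupOf G.neumannLaplacian G.neumannSemigroup := by
    rw [WeightedGraph.neumannSemigroup, dif_pos ⟨P, hP⟩]
    exact Exists.choose_spec (⟨P, hP⟩ : ∃ P, IsSemigroupOf G.neumannLaplacian P)
  have hdense : Dense (G.neumannLaplacian.domain : Set G.Ell2) := by
    refine ((hres 1 one_pos).denseRange one_pos G.neumannLaplacian_nonneg).mono ?_
    rintro _ ⟨g, rfl⟩
    obtain ⟨u, hu, -⟩ := (hres 1 one_pos).exists_domain g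
    exact hu ▸ u.2
  have hPeq : P = G.neumannSemigroup := hP.unique hsg G.neumannLaplacian_nonneg hdense
  refine ⟨fun α hα => ⟨hres α hα, fun k => ?_, fun f => ?_⟩, hsg, fun t f => ?_⟩
  · exact ContinuousLinearMap.isUnit_add_smul_one (G.restrictedLaplacian_nonneg (K k)) hα
  · simp only [WeightedGraph.restrictedResolvent_apply _ _ hα]
    refine tendsto_apply_of_tendsto (C := α⁻¹) (fun k x => ?_)
      (hK.tendsto_extendByZero_restrict f) (hconv α hα f)
    rw [le_inv_mul_iff₀ hα]
    exact ContinuousLinearMap.norm_inverse_add_smul_one_apply_le (hpos k) hα x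
  · simp only [WeightedGraph.restrictedSemigroup_apply, ← hPeq]
    refine tendsto_apply_of_tendsto (C := 1) (fun k x => ?_)
      (hK.tendsto_extendByZero_restrict f) (hPconv t f)
    rw [one_mul]
    exact ContinuousLinearMap.norm_exp_neg_smul_apply_le (hpos k) t.2 x
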